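/- Let $\phi_0(x)=\mathbf 1_{\{x\le 0\}}$ be the 0-1 loss, $\phi_1(x)=\max(0,1-x)$ the hinge loss, and for $x\in\mathbb R$ put $$\phi_h(x)=h\,\phi_1(x)+(1-h)\,\phi_0(x)\quad(0\le h\le 1),\qquad \phi_h(x)=(h-1)x^2-x+1\quad(h>1).$$ Let $\mathcal X$ be an infinite measurable space whose singletons are measurable. For a probability measure $\pi$ on $\mathcal X\times\{-1,1\}$, let $(X,Y)$ have law $\pi$, let $D_n=((X_1,Y_1),\dots,(X_n,Y_n))$ be an i.i.d. sample of $\pi$, independent of $(X,Y)$, and put $A_h(f)=\mathbb E[\phi_h(Yf(X))]$ and $A_h^*=\inf_f A_h(f)$, the infimum being over all measurable $f:\mathcal X\to\mathbb R$. Let $A_{h,n}(f)=\frac1n\sum_{i=1}^n\phi_h(Y_if(X_i))$ be the empirical risk. A statistic is a jointly measurable real function $f_n(D_n,x)$; we write $f_n(x)$ for it, and in $A_h(f_n)$ the sample is held fixed. A function $\gamma(n,M)$ is called an optimal rate of aggregation for the $\phi_h$-risk if there are constants $C_1,C_2>0$, depending only on $h$ (not on $\mathcal X$, $M$ or $n$),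 such that for every integer $M\ge2$: (i) for every family $\mathcal F=\{f_1,\dots,f_M\}$ of $M$ measurable functions $\mathcal X\to[-1,1]$ there are statistics $\tilde f_n$ $(n\ge1)$ such that, for all probability measures $\pi$ and all $n\ge1$, $$\mathbb E[A_h(\tilde f_n)-A_h^*]\le\min_{f\in\mathcal F}(A_h(f)-A_h^*)+C_1\gamma(n,M);$$ (ii) there is a set $\mathcal F$ of $M$ distinct measurable functions $\mathcal X\to[-1,1]$ such that, for every $n\ge1$ and every statistic $\bar f_n$, there is a probability measure $\pi$ (which may depend on $n$ and $\bar f_n$) with $$\mathbb E[A_h(\bar f_n)-A_h^*]\ge\min_{f\in\mathcal F}(A_h(f)-A_h^*)+C_2\min(1,\gamma(n,M)).$$ A procedure attains this rate if, for every $M\ge 2$ and every $\mathcal F$ as in (i), it satisfies the inequality in (i) with such a constant $C_1$. Given $\mathcal F$, an ERM procedure is any statistic with values in $\arg\min_{f\in\mathcal F}A_{h,n}(f)$. For $\beta>0$ and a sample of size $k$ put $$\tilde f_{k,\beta}=\sum_{j=1}^M\frac{\exp(-\beta^{-1}kA_{h,k}(f_j))}{\sum_{i=1}^M\exp(-\beta^{-1}kA_{h,k}(f_i))}\,f_j.$$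 The AEW procedure is $\tilde f_{n,1}$, and the CAEW procedure with temperature $\beta$ is $\frac1n\sum_{k=1}^n\tilde f_{k,\beta}$, where $\tilde f_{k,\beta}$ is built from the first $k$ observations. **Theorem.** - If $0\le h<1$, then $\sqrt{(\log M)/n}$ is an optimal rate of aggregation for the $\phi_h$-risk, and it is attained by every ERM procedure (and ERM procedures exist). - If $h=1$, then $\sqrt{(\log M)/n}$ is an optimal rate of aggregation for the $\phi_1$-risk, and it is attained by every ERM procedure (and these exist), by AEW, and by CAEW with temperature $1$. - If $h>1$, then $(\log M)/n$ is an optimal rate of aggregation for the $\phi_h$-risk, and it is attained by CAEW with temperature $\beta_h=\dfrac{(2h-1)^2}{2(h-1)}$. -/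

import Mathlib

open MeasureTheory

namespace Aggregation

noncomputable section

/-- The label set `{-1, 1}`. -/
abbrev Label : Type := ({-1, 1} : Set ℝ)

/-- An observation `(x, y)` with `x : 𝒳` and a label `y`. -/
abbrev Obs (𝒳 : Type*) : Type _ := 𝒳 × Label

/-- A sample of `n` observations. -/
abbrev Sample (𝒳 : Type*) (n : ℕ) : Type _ := Fin n → Obs 𝒳

/-- A real-valued classifier built from a sample of size `n`. -/
abbrev Estimator (𝒳 : Type*) (n : ℕ) : Type _ := Sample 𝒳 n → 𝒳 → ℝ

/-- A procedure gives an estimator for every sample size. -/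
abbrev Procedure (𝒳 : Type*) : Type _ := ∀ n : ℕ, Estimator 𝒳 n

/-! ### The losses -/

/-- The 0-1 loss. -/
def zeroOneLoss (x : ℝ) : ℝ := if x ≤ 0 then 1 else 0

/-- The hinge loss. -/
def hingeLoss (x : ℝ) : ℝ := max 0 (1 - x)

/-- The scale of losses indexed by `h ≥ 0`. -/
def phi (h x : ℝ) : ℝ :=
  if h ≤ 1 then h * hingeLoss x + (1 - h) * zeroOneLoss x
  else (h - 1) * x ^ 2 - x + 1

/-- The temperature attached to `phi h` when `h > 1`. -/
def temperature (h : ℝ) : ℝ := (2 * h - 1) ^ 2 / (2 * (h - 1))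

/-! ### Risks and statistics -/

section Risk

variable {𝒳 : Type*}

/-- The loss `φ (y f(x))` of `f` at the observation `z = (x, y)`. -/
def lossAt (φ : ℝ → ℝ) (f : 𝒳 → ℝ) (z : Obs 𝒳) : ℝ := φ ((z.2 : ℝ) * f z.1)

/-- The empirical `φ`-risk of `f` on the sample `D`. -/
def empRisk (φ : ℝ → ℝ) {n : ℕ} (D : Sample 𝒳 n) (f : 𝒳 → ℝ) : ℝ :=
  (1 / (n : ℝ)) * ∑ i, lossAt φ f (D i)

variable [MeasurableSpace 𝒳]

/-- The `φ`-risk of `f` when `(X, Y)` has law `π`. -/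
def risk (φ : ℝ → ℝ) (π : Measure (Obs 𝒳)) (f : 𝒳 → ℝ) : ℝ := ∫ z, lossAt φ f z ∂π

/-- The minimal `φ`-risk over all measurable real-valued functions (of finite risk: for a loss
that is bounded below, the other functions have risk `+∞`). -/
def minRisk (φ : ℝ → ℝ) (π : Measure (Obs 𝒳)) : ℝ :=
  sInf {r : ℝ | ∃ f : 𝒳 → ℝ, Measurable f ∧ Integrable (lossAt φ f) π ∧ r = risk φ π f}

/-- A statistic: an estimator that is jointly measurable in the sample and the point. -/
def IsStatistic {n : ℕ} (T : Estimator 𝒳 n) : Prop :=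
  Measurable fun p : Sample 𝒳 n × 𝒳 => T p.1 p.2

/-- The law of an i.i.d. sample of size `n`. -/
def sampleLaw (π : Measure (Obs 𝒳)) (n : ℕ) : Measure (Sample 𝒳 n) := Measure.pi fun _ => π

/-- The loss of the estimator `T` at a new independent observation is integrable, that is, its
expected risk is well defined and finite. -/
def HasFiniteExpectedRisk (φ : ℝ → ℝ) (π : Measure (Obs 𝒳)) {n : ℕ} (T : Estimator 𝒳 n) : Prop :=
  Integrable (fun p : Sample 𝒳 n × Obs 𝒳 => lossAt φ (T p.1) p.2) ((sampleLaw π n).prod π)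

/-- The expected excess `φ`-risk of the estimator `T`. -/
def expectedExcessRisk (φ : ℝ → ℝ) (π : Measure (Obs 𝒳)) {n : ℕ} (T : Estimator 𝒳 n) : ℝ :=
  ∫ D, (risk φ π (T D) - minRisk φ π) ∂(sampleLaw π n)

/-- The smallest excess `φ`-risk among `f_1, …, f_M` (a minimum, as the family is finite). -/
def oracleExcessRisk (φ : ℝ → ℝ) (π : Measure (Obs 𝒳)) {M : ℕ} (f : Fin M → 𝒳 → ℝ) : ℝ :=
  ⨅ j, (risk φ π (f j) - minRisk φ π)

/-- A family of `M` measurable functions with values in `[-1, 1]`. -/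
def IsDictionary {M : ℕ} (f : Fin M → 𝒳 → ℝ) : Prop :=
  (∀ j, Measurable (f j)) ∧ ∀ j x, f j x ∈ Set.Icc (-1 : ℝ) 1

end Risk

/-! ### The aggregation procedures -/

section Procedures

variable {𝒳 : Type*}

/-- The exponential weight of `f j` at temperature `β`. -/
def expWeight (φ : ℝ → ℝ) (β : ℝ) {M n : ℕ} (f : Fin M → 𝒳 → ℝ) (D : Sample 𝒳 n) (j : Fin M) : ℝ :=
  Real.exp (-β⁻¹ * n * empRisk φ D (f j)) / ∑ i, Real.exp (-β⁻¹ * n * empRisk φ D (f i))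

/-- Aggregation with exponential weights at temperature `β`. -/
def aewTemp (φ : ℝ → ℝ) (β : ℝ) {M : ℕ} (f : Fin M → 𝒳 → ℝ) : Procedure 𝒳 :=
  fun _ D x => ∑ j, expWeight φ β f D j * f j x

/-- The AEW procedure (temperature one). -/
def aew (φ : ℝ → ℝ) {M : ℕ} (f : Fin M → 𝒳 → ℝ) : Procedure 𝒳 := aewTemp φ 1 f

/-- The first `k` observations of a sample. -/
def firstObs {n k : ℕ} (hk : k ≤ n) (D : Sample 𝒳 n) : Sample 𝒳 k := fun i => D (Fin.castLE hk i)

/-- The CAEW procedure at temperature `β`: the mean, over `k = 1, …, n`, of the exponentially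
weighted aggregates built from the first `k` observations. -/
def caew (φ : ℝ → ℝ) (β : ℝ) {M : ℕ} (f : Fin M → 𝒳 → ℝ) : Procedure 𝒳 :=
  fun n D x => (1 / (n : ℝ)) *
    ∑ k : Fin n, aewTemp φ β f (k + 1) (firstObs (Nat.succ_le_of_lt k.isLt) D) x

/-- `T` is an empirical risk minimization procedure: a statistic with values in the set of
minimizers of the empirical `φ`-risk over `f_1, …, f_M` (ties are broken arbitrarily). -/
def IsERM [MeasurableSpace 𝒳] (φ : ℝ → ℝ) {M : ℕ} (f : Fin M → 𝒳 → ℝ) (T : Procedure 𝒳) : Prop :=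
  ∀ n, IsStatistic (T n) ∧
    ∀ D, ∃ j, T n D = f j ∧ ∀ i, empRisk φ D (f j) ≤ empRisk φ D (f i)

end Procedures

/-! ### Optimal rates of aggregation -/

section Optimality

variable {𝒳 : Type*} [MeasurableSpace 𝒳]

/-- The procedure `T` mimics the best of `f_1, …, f_M` with remainder `C * γ n M`, for every
sample size and every law of the observations. -/
def OracleInequality (φ : ℝ → ℝ) (γ : ℕ → ℕ → ℝ) (C : ℝ) {M : ℕ} (f : Fin M → 𝒳 → ℝ)
    (T : Procedure 𝒳) : Prop :=
  ∀ n : ℕ, 1 ≤ n → IsStatistic (T n) ∧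
    ∀ π : Measure (Obs 𝒳), IsProbabilityMeasure π →
      HasFiniteExpectedRisk φ π (T n) ∧
      expectedExcessRisk φ π (T n) ≤ oracleExcessRisk φ π f + C * γ n M

/-- No statistic mimics the best of `f_1, …, f_M` with a remainder smaller than
`C * min 1 (γ n M)`, uniformly over the laws of the observations. -/
def MinimaxLowerBound (φ : ℝ → ℝ) (γ : ℕ → ℕ → ℝ) (C : ℝ) {M : ℕ} (f : Fin M → 𝒳 → ℝ) : Prop :=
  ∀ n : ℕ, 1 ≤ n → ∀ T : Estimator 𝒳 n, IsStatistic T →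
    ∃ π : Measure (Obs 𝒳), IsProbabilityMeasure π ∧
      HasFiniteExpectedRisk φ π T ∧
      oracleExcessRisk φ π f + C * min 1 (γ n M) ≤ expectedExcessRisk φ π T

end Optimality

/-- `γ` is, for the space `𝒳` and the size `M`, an optimal rate of aggregation for the `φ`-risk,
with constants `C₁` and `C₂`. -/
def IsOptimalRate (𝒳 : Type*) [MeasurableSpace 𝒳] (M : ℕ) (φ : ℝ → ℝ) (γ : ℕ → ℕ → ℝ)
    (C₁ C₂ : ℝ) : Prop :=
  (∀ f : Fin M → 𝒳 → ℝ, IsDictionary f → ∃ T : Procedure 𝒳, OracleInequality φ γ C₁ f T) ∧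
  (∃ f : Fin M → 𝒳 → ℝ, IsDictionary f ∧ Function.Injective f ∧ MinimaxLowerBound φ γ C₂ f)

/-- The slow rate `√(log M / n)`. -/
def slowRate (n M : ℕ) : ℝ := √(Real.log M / n)

/-- The fast rate `(log M) / n`. -/
def fastRate (n M : ℕ) : ℝ := Real.log M / n

end

end Aggregation

/-! Upper bounds, `h ≤ 1`. On `[-1, 1]` the loss lies in `[0, 2]`, so Hoeffding's lemma and a union
bound over exponential moments make the expected largest gap between risk and empirical risk over
the dictionary at most `3/2 * √(log M / n)` (`integral_le_of_le_deviation`). For an ERM with value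
`f j`, the risk minus the empirical risk of any fixed `f i` is at most the gap of `f j`, and the
empirical risk of `f i` is unbiased. At `h = 1` the hinge loss is affine on `[-1, 1]`, so the risk
of a mixture is the mixture of the risks: AEW pays the same gap plus the entropy term `log M / n` of
the Gibbs principle, and CAEW averages these bounds over `k ≤ n`.

Upper bound, `h > 1`. At temperature `β_h` the function `exp (-φ / β)` is concave on `[-1, 1]`.
Jensen's inequality then bounds the loss of the `k`-th aggregate at a new observation by `β log Z_k
- β log Z_{k+1}`, with `Z` the normalizing constant of the weights. The expectations telescope, so
the total regret is of order `log M`, and convexity of `φ` transfers the mean over `k` to CAEW.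

Lower bounds. Take `m = ⌊log₂ M⌋` points on which the dictionary realizes all sign patterns, and
hide a vertex of the cube `{±1}^m` in the dominant labels, which have probability `(1 + ε) / 2`.
Flipping one sign changes the law of a sample little when `n q ε²` is small, `q` being the mass of
one point, so by Assouad's argument (`exists_vertex_error_ge`) every estimator gets a fixed
proportion of the signs wrong for some vertex. A dictionary member is optimal for that vertex, and
each wrong sign costs `q δ` (`exists_law_excess_ge`). For `h ≤ 1`, the points carry all the mass,
`ε` is of order `√(m / n)`, and `δ = ε`. For `h > 1`, `ε` and `δ` are constants and the total mass
of the points is of order `m / n`. -/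

namespace Aggregation

/-! ### Finitely supported laws -/

section FiniteSupport

variable {Ω : Type*} [Fintype Ω] [MeasurableSpace Ω]

/-- The measure with mass `w z` at the point `z` of a finite type. -/
noncomputable def weightMeasure (w : Ω → ℝ) : Measure Ω :=
  ∑ z, ENNReal.ofReal (w z) • Measure.dirac z

lemma isProbabilityMeasure_weightMeasure {w : Ω → ℝ} (hw : ∀ z, 0 ≤ w z) (h1 : ∑ z, w z = 1) :
    IsProbabilityMeasure (weightMeasure w) := by
  constructor
  simp only [weightMeasure, Measure.coe_finsetSum, Finset.sum_apply, Measure.smul_apply,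
    measure_univ, smul_eq_mul, mul_one]
  rw [← ENNReal.ofReal_sum_of_nonneg fun z _ => hw z, h1, ENNReal.ofReal_one]

variable [MeasurableSingletonClass Ω]

lemma weightMeasure_singleton (w : Ω → ℝ) (z : Ω) :
    weightMeasure w {z} = ENNReal.ofReal (w z) := by
  classical
  simp only [weightMeasure, Measure.coe_finsetSum, Finset.sum_apply, Measure.smul_apply,
    MeasurableSet.singleton, Measure.dirac_apply', smul_eq_mul]
  rw [Finset.sum_eq_single z]
  · simp
  · intro b _ hb
    simp [hb]
  · simp

lemma integral_weightMeasure {w : Ω → ℝ} (hw : ∀ z, 0 ≤ w z) (h1 : ∑ z, w z = 1) (g : Ω → ℝ) :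
    ∫ z, g z ∂weightMeasure w = ∑ z, w z * g z := by
  have := isProbabilityMeasure_weightMeasure hw h1
  rw [integral_fintype Integrable.of_finite]
  simp [measureReal_def, weightMeasure_singleton, hw]

lemma integral_pi_weightMeasure {w : Ω → ℝ} (hw : ∀ z, 0 ≤ w z) (h1 : ∑ z, w z = 1) {n : ℕ}
    (g : (Fin n → Ω) → ℝ) :
    ∫ d, g d ∂Measure.pi (fun _ : Fin n => weightMeasure w) = ∑ d, (∏ i, w (d i)) * g d := by
  classical
  have := isProbabilityMeasure_weightMeasure hw h1
  rw [integral_fintype Integrable.of_finite]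
  refine Finset.sum_congr rfl fun d _ => ?_
  rw [measureReal_def, Measure.pi_singleton, ENNReal.toReal_prod]
  simp [weightMeasure_singleton, hw]

/-- Change of variables along a measurable embedding asks nothing of the integrand, so risks under a
finitely supported law become finite sums for arbitrary functions and estimators. -/
lemma measurableEmbedding_of_injective {α : Type*} [Countable α] [MeasurableSpace α]
    [MeasurableSingletonClass α] {β : Type*} [MeasurableSpace β]
    [MeasurableSingletonClass β] {f : α → β} (hf : Function.Injective f) :
    MeasurableEmbedding f where
  injective := hf
  measurable := measurable_of_countable f
  measurableSet_image' := fun {s} _ => (s.to_countable.image f).measurableSet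

variable {𝒳 : Type*} [MeasurableSpace 𝒳]

lemma sampleLaw_map {ν : Measure Ω} [IsProbabilityMeasure ν] {e : Ω → Obs 𝒳}
    (n : ℕ) :
    sampleLaw (ν.map e) n = (Measure.pi fun _ : Fin n => ν).map fun d i => e (d i) := by
  have : IsProbabilityMeasure (ν.map e) :=
    Measure.isProbabilityMeasure_map (measurable_of_countable e).aemeasurable
  rw [sampleLaw, Measure.pi_map_pi fun _ => (measurable_of_countable e).aemeasurable]

variable [MeasurableSingletonClass 𝒳]

lemma measurableEmbedding_sample {e : Ω → Obs 𝒳} (he : Function.Injective e) (n : ℕ) :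
    MeasurableEmbedding fun (d : Fin n → Ω) (i : Fin n) => e (d i) :=
  measurableEmbedding_of_injective fun _ _ h => funext fun i => he (congrFun h i)

lemma risk_map_weightMeasure {w : Ω → ℝ} (hw : ∀ z, 0 ≤ w z) (h1 : ∑ z, w z = 1)
    {e : Ω → Obs 𝒳} (he : Function.Injective e) (φ : ℝ → ℝ) (g : 𝒳 → ℝ) :
    risk φ ((weightMeasure w).map e) g = ∑ z, w z * lossAt φ g (e z) := by
  rw [risk, (measurableEmbedding_of_injective he).integral_map, integral_weightMeasure hw h1]

lemma integral_sampleLaw_map_weightMeasure {w : Ω → ℝ} (hw : ∀ z, 0 ≤ w z) (h1 : ∑ z, w z = 1)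
    {e : Ω → Obs 𝒳} (he : Function.Injective e) {n : ℕ} (g : Sample 𝒳 n → ℝ) :
    ∫ D, g D ∂sampleLaw ((weightMeasure w).map e) n
      = ∑ d : Fin n → Ω, (∏ i, w (d i)) * g fun i => e (d i) := by
  have := isProbabilityMeasure_weightMeasure hw h1
  rw [sampleLaw_map, (measurableEmbedding_sample he n).integral_map,
    integral_pi_weightMeasure hw h1]

lemma hasFiniteExpectedRisk_map_weightMeasure {w : Ω → ℝ} (hw : ∀ z, 0 ≤ w z)
    (h1 : ∑ z, w z = 1) {e : Ω → Obs 𝒳} (he : Function.Injective e) (φ : ℝ → ℝ) {n : ℕ}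
    (T : Estimator 𝒳 n) : HasFiniteExpectedRisk φ ((weightMeasure w).map e) T := by
  have := isProbabilityMeasure_weightMeasure hw h1
  rw [HasFiniteExpectedRisk, sampleLaw_map, Measure.map_prod_map _ _
    (measurableEmbedding_sample he n).measurable (measurable_of_countable e),
    MeasurableEmbedding.integrable_map_iff]
  · exact Integrable.of_finite
  · exact measurableEmbedding_of_injective
      ((measurableEmbedding_sample he n).injective.prodMap he)

end FiniteSupport

/-! ### Testing on the cube -/

/-- Le Cam's inequality between the Hellinger affinity and the testing affinity: write `P Q` as `min
* max`, apply Cauchy–Schwarz, and bound the sum of the maxima by `2`. -/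
lemma sq_sum_sqrt_mul_le {Ω : Type*} [Fintype Ω] {P Q : Ω → ℝ} (hP : ∀ z, 0 ≤ P z)
    (hQ : ∀ z, 0 ≤ Q z) (hP1 : ∑ z, P z = 1) (hQ1 : ∑ z, Q z = 1) :
    (∑ z, √(P z * Q z)) ^ 2 ≤ 2 * ∑ z, min (P z) (Q z) := by
  have hmin : ∀ z, 0 ≤ min (P z) (Q z) := fun z => le_min (hP z) (hQ z)
  have hmax : ∀ z, 0 ≤ max (P z) (Q z) := fun z => (hP z).trans (le_max_left _ _)
  have h1 : ∑ z, √(P z * Q z) = ∑ z, √(min (P z) (Q z)) * √(max (P z) (Q z)) := by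
    refine Finset.sum_congr rfl fun z _ => ?_
    rw [← Real.sqrt_mul (hmin z), min_mul_max]
  have h2 := Finset.sum_mul_sq_le_sq_mul_sq Finset.univ (fun z => √(min (P z) (Q z)))
    fun z => √(max (P z) (Q z))
  simp only [Real.sq_sqrt (hmin _), Real.sq_sqrt (hmax _)] at h2
  have h3 : ∑ z, max (P z) (Q z) ≤ 2 := by
    calc ∑ z, max (P z) (Q z) ≤ ∑ z, (P z + Q z) :=
          Finset.sum_le_sum fun z _ => max_le_add_of_nonneg (hP z) (hQ z)
      _ = 2 := by rw [Finset.sum_add_distrib, hP1, hQ1]; norm_num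
  have h4 : 0 ≤ ∑ z, min (P z) (Q z) := Finset.sum_nonneg fun z _ => hmin z
  rw [h1]
  nlinarith

/-- The sign of a Boolean. -/
def boolSign (b : Bool) : ℝ := if b then 1 else -1

/-- A vertex of the cube, extended by the sign `+` at an extra coordinate. -/
def extendVertex {m : ℕ} (σ : Fin m → Bool) (o : Option (Fin m)) : Bool := o.elim true σ

/-- The probability that a label agrees (or not) with the dominant one. -/
noncomputable def agreeWeight (ε : ℝ) (b : Bool) : ℝ := if b then (1 + ε) / 2 else (1 - ε) / 2

/-- The law of a pair (position, label) attached to a vertex of the cube. -/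
noncomputable def cubeWeight {m : ℕ} (q : Option (Fin m) → ℝ) (ε : ℝ) (σ : Fin m → Bool)
    (z : Option (Fin m) × Bool) : ℝ :=
  q z.1 * agreeWeight ε (z.2 == extendVertex σ z.1)

/-- Flip one coordinate of a vertex of the cube. -/
def flipAt {m : ℕ} (i : Fin m) (σ : Fin m → Bool) : Fin m → Bool := Function.update σ i (!σ i)

lemma flipAt_involutive {m : ℕ} (i : Fin m) : Function.Involutive (flipAt i) := by
  intro σ
  simp [flipAt]

section Cube

variable {m : ℕ} {q : Option (Fin m) → ℝ} {ε : ℝ}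

lemma agreeWeight_nonneg (h0 : 0 ≤ ε) (h1 : ε ≤ 1) (b : Bool) : 0 ≤ agreeWeight ε b := by
  cases b <;> simp only [agreeWeight] <;> norm_num <;> linarith

lemma cubeWeight_nonneg (hq : ∀ o, 0 ≤ q o) (h0 : 0 ≤ ε) (h1 : ε ≤ 1) (σ : Fin m → Bool)
    (z : Option (Fin m) × Bool) : 0 ≤ cubeWeight q ε σ z :=
  mul_nonneg (hq _) (agreeWeight_nonneg h0 h1 _)

lemma sum_cubeWeight_mul (σ : Fin m → Bool) (g : Option (Fin m) × Bool → ℝ) :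
    ∑ z, cubeWeight q ε σ z * g z = ∑ o, q o * ((1 + ε) / 2 * g (o, extendVertex σ o)
      + (1 - ε) / 2 * g (o, !extendVertex σ o)) := by
  rw [Fintype.sum_prod_type]
  refine Finset.sum_congr rfl fun o _ => ?_
  simp only [Fintype.sum_bool, cubeWeight]
  cases extendVertex σ o <;> simp [agreeWeight] <;> ring

lemma sum_cubeWeight (hq1 : ∑ o, q o = 1) (σ : Fin m → Bool) : ∑ z, cubeWeight q ε σ z = 1 := by
  have := sum_cubeWeight_mul (q := q) (ε := ε) σ fun _ => 1
  simp only [mul_one] at this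
  rw [this]
  refine Eq.trans (Finset.sum_congr rfl fun o _ => ?_) hq1
  ring

/-- The two laws differ only at position `some i`, where the labels contribute `q √(1 - ε²) ≥ q (1 -
ε²)`; every other position contributes its full mass. -/
lemma sum_sqrt_cubeWeight_flipAt_ge (hq : ∀ o, 0 ≤ q o) (hq1 : ∑ o, q o = 1) (h0 : 0 ≤ ε)
    (h1 : ε ≤ 1) (σ : Fin m → Bool) (i : Fin m) :
    1 - q (some i) * ε ^ 2
      ≤ ∑ z, √(cubeWeight q ε σ z * cubeWeight q ε (flipAt i σ) z) := by
  have key : ∀ o, q o - (if o = some i then q (some i) * ε ^ 2 else 0)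
      ≤ ∑ b, √(cubeWeight q ε σ (o, b) * cubeWeight q ε (flipAt i σ) (o, b)) := by
    intro o
    by_cases ho : o = some i
    · subst ho
      have hs : 1 - ε ^ 2 ≤ √((1 - ε ^ 2)) := by
        apply Real.le_sqrt_of_sq_le
        nlinarith [sq_nonneg ε, mul_le_one₀ h1 h0 h1]
      have e1 : ∀ b, √(cubeWeight q ε σ (some i, b) * cubeWeight q ε (flipAt i σ) (some i, b))
          = q (some i) * (√(1 - ε ^ 2) / 2) := by
        intro b
        have : cubeWeight q ε σ (some i, b) * cubeWeight q ε (flipAt i σ) (some i, b)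
            = (q (some i) / 2) ^ 2 * (1 - ε ^ 2) := by
          simp only [cubeWeight, extendVertex, flipAt, Option.elim, Function.update_self]
          cases b <;> cases σ i <;> simp [agreeWeight] <;> ring
        rw [this, Real.sqrt_mul (sq_nonneg _), Real.sqrt_sq (by linarith [hq (some i)])]
        ring
      simp only [e1, if_true, Fintype.sum_bool]
      nlinarith [hq (some i)]
    · have e1 : ∀ b, √(cubeWeight q ε σ (o, b) * cubeWeight q ε (flipAt i σ) (o, b))
          = cubeWeight q ε σ (o, b) := by
        intro b
        have : cubeWeight q ε (flipAt i σ) (o, b) = cubeWeight q ε σ (o, b) := by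
          cases o with
          | none => rfl
          | some k =>
            have hk : k ≠ i := fun h => ho (by rw [h])
            simp [cubeWeight, extendVertex, flipAt, Function.update_of_ne hk]
        rw [this, Real.sqrt_mul_self (cubeWeight_nonneg hq h0 h1 σ _)]
      simp only [e1, if_neg ho, Fintype.sum_bool]
      apply le_of_eq
      simp only [cubeWeight]
      cases extendVertex σ o <;> simp [agreeWeight] <;> ring
  rw [Fintype.sum_prod_type]
  refine le_trans (le_of_eq ?_) (Finset.sum_le_sum fun o _ => key o)
  rw [Finset.sum_sub_distrib, hq1]
  simp

lemma sum_prod_cubeWeight (hq1 : ∑ o, q o = 1) (n : ℕ) (σ : Fin m → Bool) :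
    ∑ d : Fin n → Option (Fin m) × Bool, ∏ k, cubeWeight q ε σ (d k) = 1 := by
  rw [← Fintype.sum_pow, sum_cubeWeight hq1, one_pow]

/-- The Hellinger affinity is multiplicative over the sample, and Bernoulli's inequality keeps its
`n`-th power above `3 / 4`. Le Cam's inequality turns this into `(3 / 4)² / 2 = 9 / 32`. -/
lemma sum_min_cubeWeight_flipAt_ge (hq : ∀ o, 0 ≤ q o) (hq1 : ∑ o, q o = 1) (h0 : 0 ≤ ε)
    (h1 : ε ≤ 1) (n : ℕ) (σ : Fin m → Bool) (i : Fin m) (hn : n * (q (some i) * ε ^ 2) ≤ 1 / 4) :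
    9 / 32 ≤ ∑ d : Fin n → Option (Fin m) × Bool,
      min (∏ k, cubeWeight q ε σ (d k)) (∏ k, cubeWeight q ε (flipAt i σ) (d k)) := by
  have hp : ∀ σ (d : Fin n → Option (Fin m) × Bool), 0 ≤ ∏ k, cubeWeight q ε σ (d k) :=
    fun σ d => Finset.prod_nonneg fun k _ => cubeWeight_nonneg hq h0 h1 σ _
  have h2 := sq_sum_sqrt_mul_le (hp σ) (hp (flipAt i σ)) (sum_prod_cubeWeight hq1 n σ)
    (sum_prod_cubeWeight hq1 n (flipAt i σ))
  have h3 : ∑ d : Fin n → Option (Fin m) × Bool,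
      √((∏ k, cubeWeight q ε σ (d k)) * ∏ k, cubeWeight q ε (flipAt i σ) (d k))
      = (∑ z, √(cubeWeight q ε σ z * cubeWeight q ε (flipAt i σ) z)) ^ n := by
    rw [Fintype.sum_pow]
    refine Finset.sum_congr rfl fun d _ => ?_
    rw [← Finset.prod_mul_distrib, Real.sqrt_prod]
    exact fun k _ => mul_nonneg (cubeWeight_nonneg hq h0 h1 σ _) (cubeWeight_nonneg hq h0 h1 _ _)
  have hqi : q (some i) ≤ 1 := by
    rw [← hq1]
    exact Finset.single_le_sum (fun o _ => hq o) (Finset.mem_univ _)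
  have hle : q (some i) * ε ^ 2 ≤ 1 := mul_le_one₀ hqi (sq_nonneg ε) (by nlinarith)
  have h4 : 3 / 4 ≤ (∑ z, √(cubeWeight q ε σ z * cubeWeight q ε (flipAt i σ) z)) ^ n := by
    calc (3 : ℝ) / 4 ≤ 1 + n * -(q (some i) * ε ^ 2) := by linarith
      _ ≤ (1 + -(q (some i) * ε ^ 2)) ^ n := one_add_mul_le_pow (by linarith) n
      _ ≤ _ := by
        refine pow_le_pow_left₀ (by linarith) ?_ n
        rw [← sub_eq_add_neg]
        exact sum_sqrt_cubeWeight_flipAt_ge hq hq1 h0 h1 σ i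
  rw [h3] at h2
  nlinarith

/-- Assouad's lemma on the cube: some vertex is hard to recover from `n` observations. -/
lemma exists_vertex_error_ge (hq : ∀ o, 0 ≤ q o) (hq1 : ∑ o, q o = 1) (h0 : 0 ≤ ε) (h1 : ε ≤ 1)
    (n : ℕ) (hn : ∀ i, n * (q (some i) * ε ^ 2) ≤ 1 / 4)
    (t : (Fin n → Option (Fin m) × Bool) → Fin m → ℝ) :
    ∃ σ : Fin m → Bool, 9 / 64 * (m : ℝ) ≤ ∑ d : Fin n → Option (Fin m) × Bool,
      (∏ k, cubeWeight q ε σ (d k)) * ∑ i, if boolSign (σ i) * t d i ≤ 0 then 1 else 0 := by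
  by_contra! hcon
  set E : (Fin m → Bool) → Fin m → ℝ := fun σ i => ∑ d : Fin n → Option (Fin m) × Bool,
    (∏ k, cubeWeight q ε σ (d k)) * if boolSign (σ i) * t d i ≤ 0 then 1 else 0 with hE
  have hsum : ∀ σ, ∑ i, E σ i < 9 / 64 * (m : ℝ) := by
    intro σ
    refine lt_of_eq_of_lt ?_ (hcon σ)
    simp only [hE, Finset.mul_sum]
    exact Finset.sum_comm
  -- For each sample, the decision `t d i` is wrong for `σ` or for the flipped vertex (for both if
  -- it is zero), so the two errors together cover the minimum of the two likelihoods.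
  have hpair : ∀ σ i, 9 / 32 ≤ E σ i + E (flipAt i σ) i := by
    intro σ i
    refine (sum_min_cubeWeight_flipAt_ge hq hq1 h0 h1 n σ i (hn i)).trans ?_
    simp only [hE]
    rw [← Finset.sum_add_distrib]
    refine Finset.sum_le_sum fun d _ => ?_
    have hp : ∀ σ, 0 ≤ ∏ k, cubeWeight q ε σ (d k) :=
      fun σ => Finset.prod_nonneg fun k _ => cubeWeight_nonneg hq h0 h1 σ _
    have hf : boolSign (flipAt i σ i) = -boolSign (σ i) := by
      simp only [flipAt, Function.update_self, boolSign]
      cases σ i <;> simp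
    rw [hf]
    by_cases hb : boolSign (σ i) * t d i ≤ 0
    · rw [if_pos hb]
      have : (0 : ℝ) ≤ if -boolSign (σ i) * t d i ≤ 0 then 1 else 0 := by split_ifs <;> norm_num
      have := mul_nonneg (hp (flipAt i σ)) this
      linarith [min_le_left (∏ k, cubeWeight q ε σ (d k)) (∏ k, cubeWeight q ε (flipAt i σ) (d k))]
    · rw [if_neg hb, if_pos (by linarith)]
      linarith [min_le_right (∏ k, cubeWeight q ε σ (d k)) (∏ k, cubeWeight q ε (flipAt i σ) (d k))]
  -- The flip is a bijection of the cube, so averaging over all vertices halves the paired bound `9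
  -- / 32`.
  have hcoord : ∀ i, ∑ _σ : Fin m → Bool, (9 / 64 : ℝ) ≤ ∑ σ, E σ i := by
    intro i
    have hflip : ∑ σ, E (flipAt i σ) i = ∑ σ, E σ i :=
      Equiv.sum_comp (flipAt_involutive i).toPerm fun σ => E σ i
    have : ∑ _σ : Fin m → Bool, (9 / 32 : ℝ) ≤ ∑ σ, (E σ i + E (flipAt i σ) i) :=
      Finset.sum_le_sum fun σ _ => hpair σ i
    rw [Finset.sum_add_distrib, hflip] at this
    simp only [Finset.sum_const, nsmul_eq_mul] at this ⊢
    linarith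
  have htot : ∑ σ, ∑ i, E σ i < ∑ _σ : Fin m → Bool, 9 / 64 * (m : ℝ) :=
    Finset.sum_lt_sum_of_nonempty Finset.univ_nonempty fun σ _ => hsum σ
  rw [Finset.sum_comm] at htot
  have : ∑ _i : Fin m, ∑ _σ : Fin m → Bool, (9 / 64 : ℝ) ≤ ∑ i, ∑ σ, E σ i :=
    Finset.sum_le_sum fun i _ => hcoord i
  simp only [Finset.sum_const, nsmul_eq_mul, Finset.card_univ, Fintype.card_fin] at this htot
  nlinarith

end Cube

/-! ### Lower bounds -/

/-- The label with a given Boolean sign. -/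
def boolLabel (b : Bool) : Label := ⟨boolSign b, by cases b <;> simp [boolSign]⟩

lemma boolLabel_injective : Function.Injective boolLabel := by
  intro a b hab
  have := congrArg Subtype.val hab
  revert this
  cases a <;> cases b <;> simp [boolLabel, boolSign] <;> norm_num

lemma boolSign_not (b : Bool) : boolSign (!b) = -boolSign b := by cases b <;> simp [boolSign]

lemma boolSign_mul_self (b : Bool) : boolSign b * boolSign b = 1 := by cases b <;> simp [boolSign]

/-- The conditional risk of the score `u` when the dominant label `1` has probability
`(1 + ε) / 2`. -/
noncomputable def scoreRisk (φ : ℝ → ℝ) (ε u : ℝ) : ℝ := (1 + ε) / 2 * φ u + (1 - ε) / 2 * φ (-u)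

/-- A dictionary that takes all sign patterns on a set of `log₂ M` points. -/
lemma exists_shattering_dictionary (𝒳 : Type*) [MeasurableSpace 𝒳] [MeasurableSingletonClass 𝒳]
    [Infinite 𝒳] {M : ℕ} (hM : M ≠ 0) {a : ℝ} (ha0 : 0 ≤ a) (ha1 : a ≤ 1) :
    ∃ (f : Fin M → 𝒳 → ℝ) (p : Option (Fin (Nat.log 2 M)) → 𝒳), IsDictionary f ∧
      Function.Injective f ∧ Function.Injective p ∧
      ∀ σ : Fin (Nat.log 2 M) → Bool, ∃ j, ∀ o, f j (p o) = boolSign (extendVertex σ o) * a := by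
  set m := Nat.log 2 M with hm
  have hcard : Fintype.card (Fin m → Bool) ≤ Fintype.card (Fin M) := by
    simpa using Nat.pow_log_le_self 2 hM
  obtain ⟨enc⟩ := Function.Embedding.nonempty_of_card_le hcard
  -- `M` may exceed `2 ^ m`: the surplus indices repeat sign patterns.
  set vertex : Fin M → Fin m → Bool := Function.invFun enc
  have hvertex : ∀ σ, vertex (enc σ) = σ := Function.leftInverse_invFun enc.injective
  let r : Option (Option (Fin m)) → 𝒳 := fun o => Infinite.natEmbedding 𝒳 (Encodable.encode o)
  have hr : Function.Injective r :=
    (Infinite.natEmbedding 𝒳).injective.comp Encodable.encode_injective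
  -- The point `r none`, which is not one of the shattered points, carries the value `1 / (j + 1)`;
  -- it serves only to make the functions distinct.
  let g : Fin M → Option (Option (Fin m)) → ℝ := fun j o =>
    o.elim (1 / ((j : ℝ) + 1)) fun o => boolSign (extendVertex (vertex j) o) * a
  let _ : MeasurableSpace (Option (Option (Fin m))) := ⊤
  have hg : ∀ j o, g j o ∈ Set.Icc (-1 : ℝ) 1 := by
    intro j o
    cases o with
    | none =>
      have h0 : (0 : ℝ) ≤ j := Nat.cast_nonneg _
      refine ⟨le_trans (by norm_num) (show (0 : ℝ) ≤ 1 / ((j : ℝ) + 1) by positivity), ?_⟩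
      exact (div_le_one (by linarith)).2 (by linarith)
    | some o =>
      simp only [g, Option.elim, boolSign]
      split_ifs <;> constructor <;> linarith
  refine ⟨fun j => Function.extend r (g j) fun _ => 0, fun o => r (some o), ⟨?_, ?_⟩, ?_, ?_, ?_⟩
  · exact fun j => (measurableEmbedding_of_injective hr).measurable_extend
      measurable_from_top measurable_const
  · intro j x
    by_cases hx : ∃ o, r o = x
    · obtain ⟨o, rfl⟩ := hx
      simp only [hr.extend_apply]
      exact hg j o
    · simp only [Function.extend_apply' _ _ _ hx]
      constructor <;> norm_num
  · intro j k hjk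
    have := congrFun hjk (r none)
    simp only [hr.extend_apply, g, Option.elim] at this
    have hj : (j : ℝ) + 1 ≠ 0 := by positivity
    have hk : (k : ℝ) + 1 ≠ 0 := by positivity
    field_simp at this
    apply Fin.ext
    have : (j : ℝ) = k := by linarith
    exact_mod_cast this
  · exact fun o o' h => Option.some_injective _ (hr h)
  · intro σ
    refine ⟨enc σ, fun o => ?_⟩
    simp only [hr.extend_apply, g, Option.elim, hvertex]

/-- A shattering dictionary cannot be mimicked when the mass `w` on the shattered points is spread
so thin that their labels cannot be guessed. -/
lemma exists_law_excess_ge {𝒳 : Type*} [MeasurableSpace 𝒳] [MeasurableSingletonClass 𝒳]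
    {M m : ℕ} (hm : 1 ≤ m) {a : ℝ} {f : Fin M → 𝒳 → ℝ} {p : Option (Fin m) → 𝒳}
    (hp : Function.Injective p)
    (hf : ∀ σ : Fin m → Bool, ∃ j, ∀ o, f j (p o) = boolSign (extendVertex σ o) * a)
    {φ : ℝ → ℝ} {ε δ w : ℝ} (hε0 : 0 ≤ ε) (hε1 : ε ≤ 1) (hw0 : 0 ≤ w) (hw1 : w ≤ 1)
    (hmin : ∀ u, scoreRisk φ ε a ≤ scoreRisk φ ε u)
    (hgap : ∀ u ≤ 0, scoreRisk φ ε a + δ ≤ scoreRisk φ ε u) (hδ : 0 ≤ δ)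
    {n : ℕ} (hn : n * (w / m * ε ^ 2) ≤ 1 / 4) (T : Estimator 𝒳 n) :
    ∃ π : Measure (Obs 𝒳), IsProbabilityMeasure π ∧ HasFiniteExpectedRisk φ π T ∧
      oracleExcessRisk φ π f + 9 / 64 * (w * δ) ≤ expectedExcessRisk φ π T := by
  have hm0 : (0 : ℝ) < m := by exact_mod_cast hm
  -- The mass `1 - w` is parked at a point whose dominant label is always `1`, where nothing has to
  -- be learnt.
  let q : Option (Fin m) → ℝ := fun o => o.elim (1 - w) fun _ => w / m
  have hq : ∀ o, 0 ≤ q o := by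
    intro o
    cases o with
    | none => exact sub_nonneg.2 hw1
    | some i => exact div_nonneg hw0 hm0.le
  have hq1 : ∑ o, q o = 1 := by
    rw [Fintype.sum_option]
    simp only [q, Option.elim, Finset.sum_const, Finset.card_univ, Fintype.card_fin, nsmul_eq_mul]
    field_simp
    ring
  let e : Option (Fin m) × Bool → Obs 𝒳 := fun z => (p z.1, boolLabel z.2)
  have he : Function.Injective e := hp.prodMap boolLabel_injective
  let _ : MeasurableSpace (Option (Fin m)) := ⊤
  obtain ⟨σ, hσ⟩ := exists_vertex_error_ge hq hq1 hε0 hε1 n (fun i => hn)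
    fun d i => T (fun k => e (d k)) (p (some i))
  obtain ⟨j, hj⟩ := hf σ
  have hcw := cubeWeight_nonneg hq hε0 hε1 σ
  have hcs := sum_cubeWeight (ε := ε) hq1 σ
  set π := (weightMeasure (cubeWeight q ε σ)).map e with hπ
  have hprob : IsProbabilityMeasure π := by
    have := isProbabilityMeasure_weightMeasure hcw hcs
    exact Measure.isProbabilityMeasure_map (measurable_of_countable e).aemeasurable
  refine ⟨π, hprob, hasFiniteExpectedRisk_map_weightMeasure hcw hcs he φ T, ?_⟩
  have hrisk : ∀ g : 𝒳 → ℝ, risk φ π g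
      = ∑ o, q o * scoreRisk φ ε (boolSign (extendVertex σ o) * g (p o)) := by
    intro g
    rw [hπ, risk_map_weightMeasure hcw hcs he, sum_cubeWeight_mul]
    refine Finset.sum_congr rfl fun o _ => ?_
    simp only [lossAt, e, boolLabel, boolSign_not, scoreRisk, neg_mul]
  have hriskf : risk φ π (f j) = ∑ o, q o * scoreRisk φ ε a := by
    rw [hrisk]
    refine Finset.sum_congr rfl fun o _ => ?_
    rw [hj, ← mul_assoc, boolSign_mul_self, one_mul]
  -- At every position `f j` has the smallest conditional risk, and each wrong sign at a shattered
  -- point costs at least `δ` times the mass `w / m` of that point.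
  have hexcess : ∀ g : 𝒳 → ℝ, risk φ π (f j) + w / m * δ *
      ∑ i, (if boolSign (σ i) * g (p (some i)) ≤ 0 then (1 : ℝ) else 0) ≤ risk φ π g := by
    intro g
    rw [hriskf, hrisk, Fintype.sum_option, Fintype.sum_option, Finset.mul_sum, add_assoc,
      ← Finset.sum_add_distrib]
    refine add_le_add (mul_le_mul_of_nonneg_left (hmin _) (hq _)) (Finset.sum_le_sum fun i _ => ?_)
    have hqi : q (some i) = w / m := rfl
    have h0 : 0 ≤ w / (m : ℝ) := hq (some i)
    rw [hqi, mul_assoc, ← mul_add]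
    refine mul_le_mul_of_nonneg_left ?_ h0
    simp only [extendVertex, Option.elim]
    split_ifs with hb
    · rw [mul_one]
      exact hgap _ hb
    · rw [mul_zero, add_zero]
      exact hmin _
  -- An upper bound on the oracle suffices; `minRisk` is subtracted on both sides and is never
  -- computed.
  have horacle : oracleExcessRisk φ π f ≤ risk φ π (f j) - minRisk φ π :=
    ciInf_le (Set.finite_range _).bddBelow j
  refine (add_le_add_left horacle _).trans ?_
  rw [expectedExcessRisk, hπ, integral_sampleLaw_map_weightMeasure hcw hcs he, ← hπ]
  have hnonneg : ∀ d : Fin n → Option (Fin m) × Bool, 0 ≤ ∏ k, cubeWeight q ε σ (d k) :=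
    fun d => Finset.prod_nonneg fun k _ => hcw _
  calc risk φ π (f j) - minRisk φ π + 9 / 64 * (w * δ)
      = (risk φ π (f j) - minRisk φ π) + w / m * δ * (9 / 64 * m) := by field_simp
    _ ≤ (risk φ π (f j) - minRisk φ π) * ∑ d : Fin n → Option (Fin m) × Bool,
          ∏ k, cubeWeight q ε σ (d k) + w / m * δ * ∑ d : Fin n → Option (Fin m) × Bool,
          (∏ k, cubeWeight q ε σ (d k)) * ∑ i, if boolSign (σ i) *
            T (fun k => e (d k)) (p (some i)) ≤ 0 then 1 else 0 := by
        rw [sum_prod_cubeWeight hq1, mul_one]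
        have : 0 ≤ w / m * δ := by positivity
        exact add_le_add_right (mul_le_mul_of_nonneg_left hσ this) _
    _ ≤ _ := by
        rw [Finset.mul_sum, Finset.mul_sum, ← Finset.sum_add_distrib]
        refine Finset.sum_le_sum fun d _ => ?_
        have := mul_le_mul_of_nonneg_left (hexcess (T fun k => e (d k))) (hnonneg d)
        linarith

/-! ### Calibration of the noise and of the mass for the two rates -/

lemma one_le_log_two {M : ℕ} (hM : 2 ≤ M) : 1 ≤ Nat.log 2 M :=
  Nat.log_pos (by norm_num) hM

lemma log_le_two_mul_log_two {M : ℕ} (hM : 2 ≤ M) : Real.log M ≤ 2 * (Nat.log 2 M : ℝ) := by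
  have h1 : (M : ℝ) ≤ 2 ^ (Nat.log 2 M + 1) := by
    exact_mod_cast (Nat.lt_pow_succ_log_self (by norm_num) M).le
  have h2 := Real.log_le_log (by positivity) h1
  rw [Real.log_pow] at h2
  have h3 : (1 : ℝ) ≤ Nat.log 2 M := by exact_mod_cast one_le_log_two hM
  have h4 := Real.log_two_lt_d9
  push_cast at h2
  nlinarith

/-- The conditional risk is linear in the loss, so the hinge and 0-1 losses are treated separately.
Hinge: `1 - ε` at `1`, at least `1` for `u ≤ 0`. 0-1: `(1 - ε) / 2` at `1`, at least `(1 + ε) / 2`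
for `u ≤ 0`. Both gaps are at least `ε`. -/
lemma scoreRisk_phi_of_le_one {h : ℝ} (h0 : 0 ≤ h) (h1 : h ≤ 1) {ε : ℝ} (hε0 : 0 ≤ ε)
    (hε1 : ε ≤ 1) (u : ℝ) :
    scoreRisk (phi h) ε 1 + (if u ≤ 0 then ε else 0) ≤ scoreRisk (phi h) ε u := by
  have split : ∀ u, scoreRisk (phi h) ε u
      = h * scoreRisk hingeLoss ε u + (1 - h) * scoreRisk zeroOneLoss ε u := by
    intro u
    simp only [scoreRisk, phi, if_pos h1]
    ring
  have hinge : scoreRisk hingeLoss ε 1 + (if u ≤ 0 then ε else 0) ≤ scoreRisk hingeLoss ε u := by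
    have a1 : 0 ≤ hingeLoss u := le_max_left _ _
    have a2 : 1 - u ≤ hingeLoss u := le_max_right _ _
    have a3 : 0 ≤ hingeLoss (-u) := le_max_left _ _
    have a4 : 1 - -u ≤ hingeLoss (-u) := le_max_right _ _
    have b1 : hingeLoss 1 = 0 := by simp [hingeLoss]
    have b2 : hingeLoss (-1) = 2 := by norm_num [hingeLoss]
    simp only [scoreRisk, b1, b2]
    split_ifs with hu
    · by_cases hu1 : u ≤ -1
      · nlinarith [mul_nonneg (sub_nonneg.2 hε1) a3]
      · nlinarith [mul_nonneg (sub_nonneg.2 hε1) (sub_nonneg.2 a4)]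
    · by_cases hu1 : u ≤ 1
      · nlinarith [mul_nonneg (sub_nonneg.2 hε1) (sub_nonneg.2 a4)]
      · nlinarith [mul_nonneg (sub_nonneg.2 hε1) (sub_nonneg.2 a4), mul_nonneg hε0 a1]
  have zeroOne : scoreRisk zeroOneLoss ε 1 + (if u ≤ 0 then ε else 0)
      ≤ scoreRisk zeroOneLoss ε u := by
    rcases lt_trichotomy u 0 with hu | hu | hu
    · have : ¬ (-u ≤ 0) := by linarith
      simp only [scoreRisk, zeroOneLoss, if_pos hu.le, if_neg this]
      norm_num
      linarith
    · subst hu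
      simp only [scoreRisk, zeroOneLoss]
      norm_num
      linarith
    · have : -u ≤ 0 := by linarith
      simp only [scoreRisk, zeroOneLoss, if_neg (not_le.2 hu), if_pos this]
      norm_num
  rw [split, split]
  nlinarith [mul_le_mul_of_nonneg_left hinge h0,
    mul_le_mul_of_nonneg_left zeroOne (sub_nonneg.2 h1)]

lemma exists_minimaxLowerBound_slowRate {h : ℝ} (h0 : 0 ≤ h) (h1 : h ≤ 1) (𝒳 : Type*)
    [MeasurableSpace 𝒳] [MeasurableSingletonClass 𝒳] [Infinite 𝒳] {M : ℕ} (hM : 2 ≤ M) :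
    ∃ f : Fin M → 𝒳 → ℝ, IsDictionary f ∧ Function.Injective f ∧
      MinimaxLowerBound (phi h) slowRate (1 / 64) f := by
  obtain ⟨f, p, hfd, hfi, hp, hf⟩ := exists_shattering_dictionary 𝒳 (M := M) (by omega)
    zero_le_one le_rfl
  refine ⟨f, hfd, hfi, fun n hn T _ => ?_⟩
  have hm := one_le_log_two hM
  have hlog := log_le_two_mul_log_two hM
  set m := Nat.log 2 M
  have hm0 : (0 : ℝ) < m := by exact_mod_cast hm
  have hn0 : (0 : ℝ) < n := by exact_mod_cast hn
  set s := √((m : ℝ) / n)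
  have hs0 : 0 ≤ s := Real.sqrt_nonneg _
  have hs2 : s ^ 2 = m / n := Real.sq_sqrt (by positivity)
  -- With `w = 1`, the indistinguishability condition reads `n ε² / m ≤ 1 / 4`, that is, `ε ≤ s /
  -- 2`.
  set ε := min 1 s / 2 with hε
  have hmin0 : 0 ≤ min 1 s := le_min zero_le_one hs0
  have hε0 : 0 ≤ ε := by positivity
  have hε1 : ε ≤ 1 := by linarith [min_le_left 1 s]
  obtain ⟨π, hπ, hfin, hle⟩ := exists_law_excess_ge hm hp hf (φ := phi h) (δ := ε) hε0 hε1
    zero_le_one le_rfl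
    (fun u => le_trans (le_add_of_nonneg_right (by split_ifs <;> linarith))
      (scoreRisk_phi_of_le_one h0 h1 hε0 hε1 u))
    (fun u hu => by simpa [hu] using scoreRisk_phi_of_le_one h0 h1 hε0 hε1 u) hε0 (n := n)
    (by
      have : ε ^ 2 ≤ (m / n) / 4 := by
        rw [← hs2, hε, div_pow]
        have := pow_le_pow_left₀ hmin0 (min_le_right 1 s) 2
        linarith
      calc (n : ℝ) * (1 / m * ε ^ 2) ≤ n * (1 / m * ((m / n) / 4)) := by gcongr
        _ = 1 / 4 := by field_simp) T
  refine ⟨π, hπ, hfin, le_trans (add_le_add_right ?_ _) hle⟩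
  have hslow : slowRate n M ≤ 2 * s := by
    apply Real.sqrt_le_iff.2
    refine ⟨by positivity, ?_⟩
    rw [mul_pow, hs2, ← mul_div_assoc]
    gcongr
    linarith
  have : min 1 (slowRate n M) ≤ 2 * min 1 s := by
    rcases le_total 1 s with hs | hs
    · rw [min_eq_left hs]
      linarith [min_le_left 1 (slowRate n M)]
    · rw [min_eq_right hs]
      linarith [min_le_right 1 (slowRate n M)]
  rw [hε]
  linarith

lemma exists_minimaxLowerBound_fastRate {h : ℝ} (h1 : 1 < h) :
    ∃ C : ℝ, 0 < C ∧ ∀ (𝒳 : Type*) [MeasurableSpace 𝒳] [MeasurableSingletonClass 𝒳] [Infinite 𝒳]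
      {M : ℕ}, 2 ≤ M → ∃ f : Fin M → 𝒳 → ℝ, IsDictionary f ∧ Function.Injective f ∧
        MinimaxLowerBound (phi h) fastRate C f := by
  have hh : 0 < h - 1 := by linarith
  -- The conditional risk is `(h - 1) u² - ε u + 1`, with minimizer `a = ε / (2 (h - 1))`. The cap
  -- on `ε` keeps `a` in `[0, 1]`, hence admissible as a dictionary value.
  set ε := min 1 (2 * (h - 1)) with hε
  have hε0 : 0 < ε := lt_min one_pos (by linarith)
  have hε1 : ε ≤ 1 := min_le_left _ _
  set a := ε / (2 * (h - 1)) with ha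
  have ha0 : 0 < a := by positivity
  have ha1 : a ≤ 1 := (div_le_one (by linarith)).2 (min_le_right _ _)
  have hea : ε = 2 * (h - 1) * a := by rw [ha]; field_simp
  have hscore : ∀ u, scoreRisk (phi h) ε u = scoreRisk (phi h) ε a + (h - 1) * (u - a) ^ 2 := by
    intro u
    simp only [scoreRisk, phi, if_neg (not_le.2 h1), hea]
    ring
  -- `9 / 64` is the proportion of errors in Assouad's lemma, `(h - 1) a²` the price of a wrong
  -- sign, and `8` comes from `fastRate n M ≤ 8 * (m / (4 n))`.
  refine ⟨9 / 64 * ((h - 1) * a ^ 2) / 8, by positivity, fun 𝒳 _ _ _ M hM => ?_⟩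
  obtain ⟨f, p, hfd, hfi, hp, hf⟩ := exists_shattering_dictionary 𝒳 (M := M) (by omega)
    ha0.le ha1
  refine ⟨f, hfd, hfi, fun n hn T _ => ?_⟩
  have hm := one_le_log_two hM
  have hlog := log_le_two_mul_log_two hM
  set m := Nat.log 2 M
  have hm0 : (0 : ℝ) < m := by exact_mod_cast hm
  have hn0 : (0 : ℝ) < n := by exact_mod_cast hn
  -- Since `ε ≤ 1` is fixed, indistinguishability is obtained from the small mass `w / m ≤ 1 / (4
  -- n)` of each point.
  set w := min 1 ((m : ℝ) / (4 * n)) with hw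
  have hw0 : 0 ≤ w := le_min zero_le_one (by positivity)
  obtain ⟨π, hπ, hfin, hle⟩ := exists_law_excess_ge hm hp hf (φ := phi h)
    (δ := (h - 1) * a ^ 2) hε0.le hε1 hw0 (min_le_left _ _)
    (fun u => by rw [hscore u]; nlinarith [sq_nonneg (u - a)])
    (fun u hu => by
      rw [hscore u]
      have : a ^ 2 ≤ (u - a) ^ 2 := by nlinarith
      nlinarith) (by positivity) (n := n)
    (by
      calc (n : ℝ) * (w / m * ε ^ 2) ≤ n * ((m / (4 * n)) / m * 1 ^ 2) := by
            gcongr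
            exact min_le_right _ _
        _ = 1 / 4 := by field_simp) T
  refine ⟨π, hπ, hfin, le_trans (add_le_add_right ?_ _) hle⟩
  have hfast : fastRate n M ≤ 8 * (m / (4 * n)) := by
    rw [fastRate, div_le_iff₀ hn0]
    calc Real.log M ≤ 2 * m := hlog
      _ = _ := by field_simp; norm_num
  have : min 1 (fastRate n M) ≤ 8 * w := by
    rcases le_total 1 ((m : ℝ) / (4 * n)) with hs | hs
    · rw [hw, min_eq_left hs]
      linarith [min_le_left 1 (fastRate n M)]
    · rw [hw, min_eq_right hs]
      linarith [min_le_right 1 (fastRate n M)]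
  have hc : 0 ≤ 9 / 64 * ((h - 1) * a ^ 2) := by positivity
  nlinarith

/-! ### Upper bounds: measurability and integrability -/

section Bounded

variable {𝒳 : Type*} {φ : ℝ → ℝ} {B : ℝ}

lemma label_mul_mem_Icc (y : Label) {t : ℝ} (ht : t ∈ Set.Icc (-1 : ℝ) 1) :
    (y : ℝ) * t ∈ Set.Icc (-1 : ℝ) 1 := by
  obtain ⟨y, hy⟩ := y
  rcases hy with rfl | hy
  · exact ⟨by linarith [ht.2], by linarith [ht.1]⟩
  · rw [Set.mem_singleton_iff] at hy
    subst hy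
    simpa using ht

lemma lossAt_mem_Icc (hB : ∀ x ∈ Set.Icc (-1 : ℝ) 1, φ x ∈ Set.Icc 0 B) {g : 𝒳 → ℝ}
    (hg : ∀ x, g x ∈ Set.Icc (-1 : ℝ) 1) (z : Obs 𝒳) : lossAt φ g z ∈ Set.Icc 0 B :=
  hB _ (label_mul_mem_Icc z.2 (hg z.1))

lemma empRisk_mem_Icc (hB : ∀ x ∈ Set.Icc (-1 : ℝ) 1, φ x ∈ Set.Icc 0 B) {g : 𝒳 → ℝ}
    (hg : ∀ x, g x ∈ Set.Icc (-1 : ℝ) 1) {n : ℕ} (hn : 1 ≤ n) (D : Sample 𝒳 n) :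
    empRisk φ D g ∈ Set.Icc 0 B := by
  have hn0 : (0 : ℝ) < n := by positivity
  have h0 : 0 ≤ ∑ i, lossAt φ g (D i) := Finset.sum_nonneg fun i _ => (lossAt_mem_Icc hB hg _).1
  have h1 : ∑ i, lossAt φ g (D i) ≤ ∑ _i : Fin n, B :=
    Finset.sum_le_sum fun i _ => (lossAt_mem_Icc hB hg _).2
  simp only [Finset.sum_const, Finset.card_univ, Fintype.card_fin, nsmul_eq_mul] at h1
  constructor
  · exact mul_nonneg (by positivity) h0
  · rw [empRisk, one_div, inv_mul_le_iff₀ hn0]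
    exact h1

variable [MeasurableSpace 𝒳]

lemma measurable_lossAt (hφ : Measurable φ) {g : 𝒳 → ℝ} (hg : Measurable g) :
    Measurable (lossAt φ g) :=
  hφ.comp ((measurable_subtype_coe.comp measurable_snd).mul (hg.comp measurable_fst))

lemma measurable_lossAt_statistic (hφ : Measurable φ) {n : ℕ} {T : Estimator 𝒳 n}
    (hT : IsStatistic T) :
    Measurable fun p : Sample 𝒳 n × Obs 𝒳 => lossAt φ (T p.1) p.2 := by
  refine hφ.comp ((measurable_subtype_coe.comp (measurable_snd.comp measurable_snd)).mul ?_)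
  exact hT.comp (measurable_fst.prodMk (measurable_fst.comp measurable_snd))

lemma measurable_empRisk (hφ : Measurable φ) {g : 𝒳 → ℝ} (hg : Measurable g) (n : ℕ) :
    Measurable fun D : Sample 𝒳 n => empRisk φ D g :=
  measurable_const.mul (Finset.measurable_sum _ fun i _ =>
    (measurable_lossAt hφ hg).comp (measurable_pi_apply i))

instance isProbabilityMeasure_sampleLaw (π : Measure (Obs 𝒳)) [IsProbabilityMeasure π] (n : ℕ) :
    IsProbabilityMeasure (sampleLaw π n) := by
  unfold sampleLaw
  infer_instance

variable {π : Measure (Obs 𝒳)} [IsProbabilityMeasure π]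

lemma integrable_lossAt (hφ : Measurable φ) (hB : ∀ x ∈ Set.Icc (-1 : ℝ) 1, φ x ∈ Set.Icc 0 B)
    {g : 𝒳 → ℝ} (hgm : Measurable g) (hg : ∀ x, g x ∈ Set.Icc (-1 : ℝ) 1) :
    Integrable (lossAt φ g) π :=
  Integrable.of_mem_Icc 0 B (measurable_lossAt hφ hgm).aemeasurable
    (ae_of_all _ (lossAt_mem_Icc hB hg))

lemma risk_mem_Icc (hφ : Measurable φ) (hB : ∀ x ∈ Set.Icc (-1 : ℝ) 1, φ x ∈ Set.Icc 0 B)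
    {g : 𝒳 → ℝ} (hgm : Measurable g) (hg : ∀ x, g x ∈ Set.Icc (-1 : ℝ) 1) :
    risk φ π g ∈ Set.Icc 0 B := by
  refine ⟨integral_nonneg fun z => (lossAt_mem_Icc hB hg z).1, ?_⟩
  refine (integral_mono (integrable_lossAt hφ hB hgm hg) (integrable_const B)
    fun z => (lossAt_mem_Icc hB hg z).2).trans ?_
  simp

lemma hasFiniteExpectedRisk_of_mem_Icc (hφ : Measurable φ)
    (hB : ∀ x ∈ Set.Icc (-1 : ℝ) 1, φ x ∈ Set.Icc 0 B) {n : ℕ} {T : Estimator 𝒳 n}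
    (hT : IsStatistic T) (hI : ∀ D x, T D x ∈ Set.Icc (-1 : ℝ) 1) :
    HasFiniteExpectedRisk φ π T :=
  Integrable.of_mem_Icc 0 B (measurable_lossAt_statistic hφ hT).aemeasurable
    (ae_of_all _ fun p => lossAt_mem_Icc hB (hI p.1) p.2)

lemma integrable_risk_of_mem_Icc (hφ : Measurable φ)
    (hB : ∀ x ∈ Set.Icc (-1 : ℝ) 1, φ x ∈ Set.Icc 0 B) {n : ℕ} {T : Estimator 𝒳 n}
    (hT : IsStatistic T) (hI : ∀ D x, T D x ∈ Set.Icc (-1 : ℝ) 1) :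
    Integrable (fun D => risk φ π (T D)) (sampleLaw π n) :=
  (hasFiniteExpectedRisk_of_mem_Icc hφ hB hT hI).integral_prod_left

lemma integrable_lossAt_eval (hφ : Measurable φ)
    (hB : ∀ x ∈ Set.Icc (-1 : ℝ) 1, φ x ∈ Set.Icc 0 B) {g : 𝒳 → ℝ} (hgm : Measurable g)
    (hg : ∀ x, g x ∈ Set.Icc (-1 : ℝ) 1) {n : ℕ} (i : Fin n) :
    Integrable (fun D => lossAt φ g (D i)) (sampleLaw π n) :=
  (measurePreserving_eval (fun _ => π) i).integrable_comp_of_integrable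
    (integrable_lossAt hφ hB hgm hg)

lemma integrable_empRisk (hφ : Measurable φ) (hB : ∀ x ∈ Set.Icc (-1 : ℝ) 1, φ x ∈ Set.Icc 0 B)
    {g : 𝒳 → ℝ} (hgm : Measurable g) (hg : ∀ x, g x ∈ Set.Icc (-1 : ℝ) 1) (n : ℕ) :
    Integrable (fun D => empRisk φ D g) (sampleLaw π n) :=
  (integrable_finsetSum _ fun i _ => integrable_lossAt_eval hφ hB hgm hg i).const_mul _

lemma integral_sum_lossAt (hφ : Measurable φ)
    (hB : ∀ x ∈ Set.Icc (-1 : ℝ) 1, φ x ∈ Set.Icc 0 B)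
    {g : 𝒳 → ℝ} (hgm : Measurable g) (hg : ∀ x, g x ∈ Set.Icc (-1 : ℝ) 1) (n : ℕ) :
    ∫ D, ∑ i, lossAt φ g (D i) ∂sampleLaw π n = n * risk φ π g := by
  rw [integral_finsetSum _ fun i _ => integrable_lossAt_eval hφ hB hgm hg i]
  have : ∀ i : Fin n, ∫ D, lossAt φ g (D i) ∂sampleLaw π n = risk φ π g := fun i =>
    integral_comp_eval (μ := fun _ : Fin n => π) (i := i)
      (measurable_lossAt hφ hgm).aestronglyMeasurable
  simp [this]

lemma integral_empRisk (hφ : Measurable φ) (hB : ∀ x ∈ Set.Icc (-1 : ℝ) 1, φ x ∈ Set.Icc 0 B)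
    {g : 𝒳 → ℝ} (hgm : Measurable g) (hg : ∀ x, g x ∈ Set.Icc (-1 : ℝ) 1) {n : ℕ} (hn : 1 ≤ n) :
    ∫ D, empRisk φ D g ∂sampleLaw π n = risk φ π g := by
  have : (n : ℝ) ≠ 0 := by positivity
  simp only [empRisk]
  rw [integral_const_mul, integral_sum_lossAt hφ hB hgm hg]
  field_simp

/-- `minRisk` is a constant that cancels, so only the expected risk has to be compared with the risk
of each `f i`. -/
lemma oracleInequality_of_integral_risk_le (hφ : Measurable φ)
    (hB : ∀ x ∈ Set.Icc (-1 : ℝ) 1, φ x ∈ Set.Icc 0 B) {M : ℕ} (hM : 2 ≤ M)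
    {f : Fin M → 𝒳 → ℝ} {γ : ℕ → ℕ → ℝ} {C : ℝ} {T : Procedure 𝒳}
    (hT : ∀ n, IsStatistic (T n)) (hI : ∀ n D x, T n D x ∈ Set.Icc (-1 : ℝ) 1)
    (hle : ∀ n, 1 ≤ n → ∀ π : Measure (Obs 𝒳), IsProbabilityMeasure π → ∀ i,
      ∫ D, risk φ π (T n D) ∂sampleLaw π n ≤ risk φ π (f i) + C * γ n M) :
    OracleInequality φ γ C f T := by
  refine fun n hn => ⟨hT n, fun π hπ => ⟨hasFiniteExpectedRisk_of_mem_Icc hφ hB (hT n) (hI n), ?_⟩⟩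
  have : Nonempty (Fin M) := ⟨⟨0, by omega⟩⟩
  rw [← sub_le_iff_le_add]
  refine le_ciInf fun i => ?_
  rw [expectedExcessRisk, integral_sub (integrable_risk_of_mem_Icc hφ hB (hT n) (hI n))
    (integrable_const _)]
  simp only [integral_const, probReal_univ, one_smul]
  linarith [hle n hn π hπ i]

end Bounded

/-! ### The maximal inequality -/

section Maximal

variable {𝒳 : Type*} [MeasurableSpace 𝒳] {φ : ℝ → ℝ} {π : Measure (Obs 𝒳)}
  [IsProbabilityMeasure π]

/-- Hoeffding's lemma: a loss in `[0, 2]` is sub-Gaussian with variance proxy `1`. Independence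
turns the exponential moment of the mean into an `n`-th power. -/
lemma integral_exp_deviation_le (hφ : Measurable φ)
    (hB : ∀ x ∈ Set.Icc (-1 : ℝ) 1, φ x ∈ Set.Icc 0 2) {g : 𝒳 → ℝ} (hgm : Measurable g)
    (hg : ∀ x, g x ∈ Set.Icc (-1 : ℝ) 1) {n : ℕ} (hn : 1 ≤ n) (l : ℝ) :
    ∫ D, Real.exp (l * (risk φ π g - empRisk φ D g)) ∂sampleLaw π n
      ≤ Real.exp (l ^ 2 / (2 * n)) := by
  have hn0 : (n : ℝ) ≠ 0 := by positivity
  have hprod : ∀ D : Sample 𝒳 n, Real.exp (l * (risk φ π g - empRisk φ D g))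
      = ∏ i, Real.exp (-(l / n) * (lossAt φ g (D i) - risk φ π g)) := by
    intro D
    rw [← Real.exp_sum, ← Finset.mul_sum, Finset.sum_sub_distrib, empRisk]
    congr 1
    simp only [Finset.sum_const, Finset.card_univ, Fintype.card_fin, nsmul_eq_mul]
    field_simp
    ring
  have hmgf := (ProbabilityTheory.hasSubgaussianMGF_of_mem_Icc (μ := π) (a := 0) (b := 2)
    (measurable_lossAt hφ hgm).aemeasurable
    (ae_of_all _ (lossAt_mem_Icc hB hg))).mgf_le (-(l / n))
  have hc : (((‖(2 : ℝ) - 0‖₊ / 2) ^ 2 : NNReal) : ℝ) = 1 := by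
    push_cast
    norm_num
  rw [hc] at hmgf
  simp only [hprod]
  rw [sampleLaw, integral_fintype_prod_eq_pow (ι := Fin n) (μ := π)
    fun z => Real.exp (-(l / n) * (lossAt φ g z - risk φ π g)), Fintype.card_fin]
  calc (∫ z, Real.exp (-(l / n) * (lossAt φ g z - risk φ π g)) ∂π) ^ n
      ≤ Real.exp (1 * (-(l / n)) ^ 2 / 2) ^ n := by
        refine pow_le_pow_left₀ (integral_nonneg fun z => (Real.exp_pos _).le) hmgf n
    _ = Real.exp (l ^ 2 / (2 * n)) := by
        rw [← Real.exp_nat_mul]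
        congr 1
        field_simp

/-- The expected maximal deviation of the empirical risks over a dictionary. -/
lemma integral_le_of_le_deviation (hφ : Measurable φ)
    (hB : ∀ x ∈ Set.Icc (-1 : ℝ) 1, φ x ∈ Set.Icc 0 2) {M : ℕ} (hM : 2 ≤ M)
    {f : Fin M → 𝒳 → ℝ} (hf : IsDictionary f) {n : ℕ} (hn : 1 ≤ n) {R : Sample 𝒳 n → ℝ}
    (hR : Integrable R (sampleLaw π n))
    (hle : ∀ D, ∃ j, R D ≤ risk φ π (f j) - empRisk φ D (f j)) :
    ∫ D, R D ∂sampleLaw π n ≤ 3 / 2 * slowRate n M := by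
  have hn0 : (0 : ℝ) < n := by positivity
  have hM1 : (1 : ℝ) < M := by exact_mod_cast hM
  have hM0 : (0 : ℝ) < M := by linarith
  have hlog : 0 < Real.log M := Real.log_pos hM1
  set s := slowRate n M with hs
  have hs0 : 0 < s := Real.sqrt_pos.2 (by positivity)
  have hs2 : s ^ 2 = Real.log M / n := Real.sq_sqrt (by positivity)
  have hlogs : Real.log M = n * s ^ 2 := by rw [hs2]; field_simp
  -- This choice balances the two terms of `c`: `log M = n s²` and `l² / (2 n) = n s² / 2`, so `c /
  -- l = 3 / 2 * s`.
  set l : ℝ := n * s with hl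
  have hl0 : 0 < l := by positivity
  set c := Real.log M + l ^ 2 / (2 * n) with hc
  have hexp : ∀ j, Integrable (fun D => Real.exp (l * (risk φ π (f j) - empRisk φ D (f j))))
      (sampleLaw π n) := by
    intro j
    refine Integrable.of_mem_Icc 0 (Real.exp (l * 2)) ?_ (ae_of_all _ fun D => ⟨?_, ?_⟩)
    · exact (Real.measurable_exp.comp (measurable_const.mul
        (measurable_const.sub (measurable_empRisk hφ (hf.1 j) n)))).aemeasurable
    · exact (Real.exp_pos _).le
    · refine Real.exp_le_exp.2 (mul_le_mul_of_nonneg_left ?_ hl0.le)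
      linarith [(risk_mem_Icc (π := π) hφ hB (hf.1 j) (hf.2 j)).2,
        (empRisk_mem_Icc hB (hf.2 j) hn D).1]
  -- A linearized form of Jensen's inequality for the logarithm, `x ≤ exp (x - c) + c - 1`, with `c`
  -- chosen so that the exponential term has expectation at most `1`.
  have hpt : ∀ D, l * R D ≤ Real.exp (-c) *
      ∑ j, Real.exp (l * (risk φ π (f j) - empRisk φ D (f j))) + (c - 1) := by
    intro D
    obtain ⟨j, hj⟩ := hle D
    have h1 := Real.add_one_le_exp (l * R D - c)
    have h2 : Real.exp (l * R D) ≤ ∑ j, Real.exp (l * (risk φ π (f j) - empRisk φ D (f j))) :=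
      (Real.exp_le_exp.2 (mul_le_mul_of_nonneg_left hj hl0.le)).trans
        (Finset.single_le_sum (f := fun j => Real.exp (l * (risk φ π (f j) - empRisk φ D (f j))))
          (fun j _ => (Real.exp_pos _).le) (Finset.mem_univ j))
    have h3 := mul_le_mul_of_nonneg_left h2 (Real.exp_pos (-c)).le
    rw [← Real.exp_add, show -c + l * R D = l * R D - c by ring] at h3
    linarith
  have hint := integral_mono (hR.const_mul l)
    (((integrable_finsetSum _ fun j _ => hexp j).const_mul (Real.exp (-c))).add
      (integrable_const (c - 1))) hpt
  rw [integral_add' ((integrable_finsetSum _ fun j _ => hexp j).const_mul _) (integrable_const _),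
    integral_const_mul, integral_const_mul, integral_finsetSum _ fun j _ => hexp j] at hint
  have hsum : ∑ j, ∫ D, Real.exp (l * (risk φ π (f j) - empRisk φ D (f j))) ∂sampleLaw π n
      ≤ Real.exp c := by
    calc _ ≤ ∑ _j : Fin M, Real.exp (l ^ 2 / (2 * n)) :=
          Finset.sum_le_sum fun j _ => integral_exp_deviation_le hφ hB (hf.1 j) (hf.2 j) hn l
      _ = Real.exp c := by
        rw [hc, Real.exp_add, Real.exp_log hM0]
        simp
  have hone := mul_le_mul_of_nonneg_left hsum (Real.exp_pos (-c)).le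
  rw [← Real.exp_add, neg_add_cancel, Real.exp_zero] at hone
  simp only [integral_const, probReal_univ, one_smul] at hint
  have hcl : c = l * (3 / 2 * s) := by
    rw [hc, hlogs, hl]
    field_simp
    ring
  refine le_of_mul_le_mul_left ?_ hl0
  linarith

end Maximal

/-! ### Empirical risk minimization -/

section ERM

variable {𝒳 : Type*} [MeasurableSpace 𝒳] {φ : ℝ → ℝ}

lemma exists_isERM (hφ : Measurable φ) {M : ℕ} (hM : 2 ≤ M) {f : Fin M → 𝒳 → ℝ}
    (hf : IsDictionary f) : ∃ T, IsERM φ f T := by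
  classical
  have : Nonempty (Fin M) := ⟨⟨0, by omega⟩⟩
  let P : ∀ n, Sample 𝒳 n → ℕ → Prop := fun n D k =>
    ∃ hk : k < M, ∀ i, empRisk φ D (f ⟨k, hk⟩) ≤ empRisk φ D (f i)
  have hex : ∀ n D, ∃ k, P n D k := by
    intro n D
    obtain ⟨j, hj⟩ := Finite.exists_min fun j => empRisk φ D (f j)
    exact ⟨j, j.2, hj⟩
  have hmeas : ∀ n k, MeasurableSet {D | P n D k} := by
    intro n k
    by_cases hk : k < M
    · have : {D | P n D k} = ⋂ i, {D | empRisk φ D (f ⟨k, hk⟩) ≤ empRisk φ D (f i)} := by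
        ext D
        simp [P, hk]
      rw [this]
      exact MeasurableSet.iInter fun i => measurableSet_le (measurable_empRisk hφ (hf.1 _) n)
        (measurable_empRisk hφ (hf.1 _) n)
    · have : {D | P n D k} = ∅ := by
        ext D
        simp [P, hk]
      rw [this]
      exact MeasurableSet.empty
  -- Ties go to the smallest minimizing index, which makes the selected index measurable in the
  -- sample.
  let J : ∀ n, Sample 𝒳 n → Fin M := fun n D =>
    ⟨Nat.find (hex n D), (Nat.find_spec (hex n D)).choose⟩
  have hJ : ∀ n, Measurable (J n) := by
    intro n
    refine measurable_to_countable' fun j => ?_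
    have : J n ⁻¹' {j} = (fun D => Nat.find (hex n D)) ⁻¹' {(j : ℕ)} := by
      ext D
      simp [J, Fin.ext_iff]
    rw [this]
    exact measurable_find (hex n) (hmeas n) (measurableSet_singleton _)
  refine ⟨fun n D => f (J n D), fun n => ⟨?_, fun D => ⟨J n D, rfl, ?_⟩⟩⟩
  · have hjoint : Measurable fun q : Fin M × 𝒳 => f q.1 q.2 :=
      measurable_from_prod_countable_right fun j => hf.1 j
    exact hjoint.comp (((hJ n).comp measurable_fst).prodMk measurable_snd)
  · exact (Nat.find_spec (hex n D)).choose_spec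

lemma slowRate_nonneg (n M : ℕ) : 0 ≤ slowRate n M := Real.sqrt_nonneg _

lemma oracleInequality_of_isERM (hφ : Measurable φ)
    (hB : ∀ x ∈ Set.Icc (-1 : ℝ) 1, φ x ∈ Set.Icc 0 2) {M : ℕ} (hM : 2 ≤ M)
    {f : Fin M → 𝒳 → ℝ} (hf : IsDictionary f) {T : Procedure 𝒳} (hT : IsERM φ f T) {C : ℝ}
    (hC : 3 / 2 ≤ C) : OracleInequality φ slowRate C f T := by
  have hI : ∀ n D x, T n D x ∈ Set.Icc (-1 : ℝ) 1 := by
    intro n D x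
    obtain ⟨j, hj, -⟩ := (hT n).2 D
    rw [hj]
    exact hf.2 j x
  refine oracleInequality_of_integral_risk_le hφ hB hM (fun n => (hT n).1) hI
    fun n hn π hπ i => ?_
  have h1 := integrable_risk_of_mem_Icc (π := π) hφ hB (hT n).1 (hI n)
  have h2 := integrable_empRisk (π := π) hφ hB (hf.1 i) (hf.2 i) n
  have := integral_le_of_le_deviation (π := π) hφ hB hM hf hn (h1.sub h2) fun D => by
    obtain ⟨j, hj, hmin⟩ := (hT n).2 D
    refine ⟨j, ?_⟩
    simp only [Pi.sub_apply, hj]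
    linarith [hmin i]
  rw [integral_sub' h1 h2, integral_empRisk hφ hB (hf.1 i) (hf.2 i) hn] at this
  have := mul_le_mul_of_nonneg_right hC (slowRate_nonneg n M)
  linarith

end ERM

/-! ### Exponential weights -/

section Weights

variable {𝒳 : Type*} {φ : ℝ → ℝ} {β : ℝ} {M : ℕ} {f : Fin M → 𝒳 → ℝ} {n : ℕ}

/-- The normalizing constant of the exponential weights. -/
noncomputable def partitionSum (φ : ℝ → ℝ) (β : ℝ) {M n : ℕ} (f : Fin M → 𝒳 → ℝ)
    (D : Sample 𝒳 n) : ℝ := ∑ j, Real.exp (-β⁻¹ * ∑ i, lossAt φ (f j) (D i))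

lemma natCast_mul_empRisk (D : Sample 𝒳 n) (g : 𝒳 → ℝ) :
    n * empRisk φ D g = ∑ i, lossAt φ g (D i) := by
  rcases Nat.eq_zero_or_pos n with rfl | hn
  · simp
  · have : (n : ℝ) ≠ 0 := by positivity
    rw [empRisk]
    field_simp

lemma expWeight_eq (D : Sample 𝒳 n) (j : Fin M) :
    expWeight φ β f D j
      = Real.exp (-β⁻¹ * ∑ i, lossAt φ (f j) (D i)) / partitionSum φ β f D := by
  simp only [expWeight, partitionSum, mul_assoc, natCast_mul_empRisk]

lemma partitionSum_pos (hM : 2 ≤ M) (D : Sample 𝒳 n) : 0 < partitionSum φ β f D := by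
  have : Nonempty (Fin M) := ⟨⟨0, by omega⟩⟩
  exact Finset.sum_pos (fun j _ => Real.exp_pos _) Finset.univ_nonempty

lemma expWeight_pos (hM : 2 ≤ M) (D : Sample 𝒳 n) (j : Fin M) : 0 < expWeight φ β f D j := by
  rw [expWeight_eq]
  exact div_pos (Real.exp_pos _) (partitionSum_pos hM D)

lemma sum_expWeight (hM : 2 ≤ M) (D : Sample 𝒳 n) : ∑ j, expWeight φ β f D j = 1 := by
  simp only [expWeight_eq]
  rw [← Finset.sum_div]
  exact div_self (partitionSum_pos hM D).ne'

lemma sum_mul_mem_Icc {ι : Type*} [Fintype ι] {w a : ι → ℝ} (hw : ∀ j, 0 ≤ w j)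
    (h1 : ∑ j, w j = 1) (ha : ∀ j, a j ∈ Set.Icc (-1 : ℝ) 1) :
    ∑ j, w j * a j ∈ Set.Icc (-1 : ℝ) 1 :=
  (convex_Icc (-1 : ℝ) 1).sum_mem (fun j _ => hw j) h1 fun j _ => ha j

lemma aewTemp_mem_Icc (hM : 2 ≤ M) (hf : ∀ j x, f j x ∈ Set.Icc (-1 : ℝ) 1) (D : Sample 𝒳 n)
    (x : 𝒳) : aewTemp φ β f n D x ∈ Set.Icc (-1 : ℝ) 1 :=
  sum_mul_mem_Icc (fun j => (expWeight_pos hM D j).le) (sum_expWeight hM D) fun j => hf j x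

lemma caew_mem_Icc (hM : 2 ≤ M) (hf : ∀ j x, f j x ∈ Set.Icc (-1 : ℝ) 1) (D : Sample 𝒳 n)
    (x : 𝒳) : caew φ β f n D x ∈ Set.Icc (-1 : ℝ) 1 := by
  rcases Nat.eq_zero_or_pos n with rfl | hn
  · simp [caew]
  · simp only [caew, Finset.mul_sum]
    refine sum_mul_mem_Icc (fun _ => by positivity) ?_ fun k => aewTemp_mem_Icc hM hf _ x
    have : (n : ℝ) ≠ 0 := by positivity
    simp [this]

/-- The Gibbs variational principle for the exponential weights at temperature one. -/
lemma sum_expWeight_mul_empRisk_le (hM : 2 ≤ M) (hn : 1 ≤ n) (D : Sample 𝒳 n) (i : Fin M) :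
    ∑ j, expWeight φ 1 f D j * empRisk φ D (f j) ≤ empRisk φ D (f i) + Real.log M / n := by
  have hn0 : (0 : ℝ) < n := by positivity
  have hM0 : (0 : ℝ) < M := by positivity
  have hZ := partitionSum_pos (φ := φ) (β := 1) (f := f) hM D
  set Z := partitionSum φ 1 f D with hZd
  have hw : ∀ j, expWeight φ 1 f D j = Real.exp (-(n * empRisk φ D (f j))) / Z := by
    intro j
    rw [expWeight_eq, natCast_mul_empRisk, inv_one, neg_one_mul]
  have hi : -(n * empRisk φ D (f i)) ≤ Real.log Z := by
    rw [Real.le_log_iff_exp_le hZ, hZd, partitionSum]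
    simp only [← natCast_mul_empRisk, inv_one, neg_one_mul]
    exact Finset.single_le_sum (f := fun j => Real.exp (-(n * empRisk φ D (f j))))
      (fun j _ => (Real.exp_pos _).le) (Finset.mem_univ i)
  -- The parenthesis is the logarithm of `(1 / M) / w_j`. Summed over `j`, this is the nonnegativity
  -- of the relative entropy of the weights with respect to the uniform law.
  have hj : ∀ j, expWeight φ 1 f D j * (n * empRisk φ D (f j) + Real.log Z - Real.log M)
      ≤ 1 / M - expWeight φ 1 f D j := by
    intro j
    have h1 := Real.add_one_le_exp (n * empRisk φ D (f j) + Real.log Z - Real.log M)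
    have h2 := mul_le_mul_of_nonneg_left h1 (expWeight_pos (φ := φ) (β := 1) (f := f) hM D j).le
    have h3 : expWeight φ 1 f D j * Real.exp (n * empRisk φ D (f j) + Real.log Z - Real.log M)
        = 1 / M := by
      rw [hw, Real.exp_sub, Real.exp_add, Real.exp_log hZ, Real.exp_log hM0, Real.exp_neg]
      have := Real.exp_pos (n * empRisk φ D (f j))
      field_simp
    rw [h3] at h2
    linarith
  have hsum := Finset.sum_le_sum fun j (_ : j ∈ Finset.univ) => hj j
  rw [Finset.sum_sub_distrib, sum_expWeight hM] at hsum
  have e1 : ∑ j, expWeight φ 1 f D j * (n * empRisk φ D (f j) + Real.log Z - Real.log M)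
      = n * ∑ j, expWeight φ 1 f D j * empRisk φ D (f j) + (Real.log Z - Real.log M) := by
    calc _ = ∑ j, (n * (expWeight φ 1 f D j * empRisk φ D (f j))
          + expWeight φ 1 f D j * (Real.log Z - Real.log M)) :=
          Finset.sum_congr rfl fun j _ => by ring
      _ = _ := by
        rw [Finset.sum_add_distrib, ← Finset.mul_sum, ← Finset.sum_mul, sum_expWeight hM, one_mul]
  have e2 : ∑ _j : Fin M, (1 : ℝ) / M = 1 := by
    simp [hM0.ne']
  rw [e1, e2] at hsum
  refine le_of_mul_le_mul_left ?_ hn0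
  rw [mul_add, mul_div_cancel₀ _ hn0.ne']
  linarith

variable [MeasurableSpace 𝒳]

lemma IsStatistic.measurable_apply {T : Estimator 𝒳 n} (hT : IsStatistic T) (D : Sample 𝒳 n) :
    Measurable (T D) :=
  Measurable.comp (g := fun p : Sample 𝒳 n × 𝒳 => T p.1 p.2) hT
    (measurable_const.prodMk measurable_id)

lemma measurable_expWeight (hφ : Measurable φ) (hf : ∀ j, Measurable (f j)) (j : Fin M) :
    Measurable fun D : Sample 𝒳 n => expWeight φ β f D j := by
  have h : ∀ j, Measurable fun D : Sample 𝒳 n => Real.exp (-β⁻¹ * n * empRisk φ D (f j)) :=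
    fun j => Real.measurable_exp.comp (measurable_const.mul (measurable_empRisk hφ (hf j) n))
  exact (h j).div (Finset.measurable_sum _ fun i _ => h i)

lemma isStatistic_aewTemp (hφ : Measurable φ) (hf : ∀ j, Measurable (f j)) (n : ℕ) :
    IsStatistic (aewTemp φ β f n) :=
  Finset.measurable_sum _ fun j _ =>
    ((measurable_expWeight hφ hf j).comp measurable_fst).mul ((hf j).comp measurable_snd)

lemma measurable_firstObs {k : ℕ} (hk : k ≤ n) :
    Measurable (firstObs hk : Sample 𝒳 n → Sample 𝒳 k) :=
  measurable_pi_lambda _ fun _ => measurable_pi_apply _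

lemma IsStatistic.comp_firstObs {k : ℕ} {T : Estimator 𝒳 k} (hT : IsStatistic T) (hk : k ≤ n) :
    Measurable fun p : Sample 𝒳 n × 𝒳 => T (firstObs hk p.1) p.2 :=
  Measurable.comp hT (((measurable_firstObs hk).comp measurable_fst).prodMk measurable_snd)

lemma isStatistic_caew (hφ : Measurable φ) (hf : ∀ j, Measurable (f j)) (n : ℕ) :
    IsStatistic (caew φ β f n) := by
  have h : ∀ k : ℕ, IsStatistic (aewTemp φ β f k) := isStatistic_aewTemp hφ hf
  unfold IsStatistic caew
  exact measurable_const.mul (Finset.measurable_sum _ fun k _ => (h _).comp_firstObs _)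

lemma measurePreserving_firstObs (π : Measure (Obs 𝒳)) [IsProbabilityMeasure π] {k : ℕ}
    (hk : k ≤ n) : MeasurePreserving (firstObs hk) (sampleLaw π n) (sampleLaw π k) := by
  refine ⟨measurable_firstObs hk, ?_⟩
  have hind : ProbabilityTheory.iIndepFun (fun (i : Fin n) (D : Sample 𝒳 n) => D i)
      (sampleLaw π n) := ProbabilityTheory.iIndepFun_pi (X := fun _ z => z)
        fun _ => measurable_id.aemeasurable
  have hmap := (ProbabilityTheory.iIndepFun_iff_map_fun_eq_pi_map
    fun i => (measurable_pi_apply _).aemeasurable).1 (hind.precomp (Fin.castLE_injective hk))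
  calc (sampleLaw π n).map (firstObs hk)
      = Measure.pi fun i => (sampleLaw π n).map fun D => D (Fin.castLE hk i) := hmap
    _ = sampleLaw π k := by
      rw [sampleLaw, sampleLaw]
      congr 1
      funext i
      exact (measurePreserving_eval (fun _ : Fin n => π) (Fin.castLE hk i)).map_eq

lemma integral_risk_firstObs {B : ℝ} (hφ : Measurable φ)
    (hB : ∀ x ∈ Set.Icc (-1 : ℝ) 1, φ x ∈ Set.Icc 0 B) {π : Measure (Obs 𝒳)}
    [IsProbabilityMeasure π] {k : ℕ} (hk : k ≤ n) {T : Estimator 𝒳 k} (hT : IsStatistic T)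
    (hI : ∀ D x, T D x ∈ Set.Icc (-1 : ℝ) 1) :
    Integrable (fun D => risk φ π (T (firstObs hk D))) (sampleLaw π n) ∧
      ∫ D, risk φ π (T (firstObs hk D)) ∂sampleLaw π n = ∫ D, risk φ π (T D) ∂sampleLaw π k := by
  have hmp := measurePreserving_firstObs π hk
  have hint := integrable_risk_of_mem_Icc (π := π) hφ hB hT hI
  refine ⟨hmp.integrable_comp_of_integrable hint, ?_⟩
  have h := integral_map (μ := sampleLaw π n) hmp.measurable.aemeasurable
    (f := fun D => risk φ π (T D)) (by rw [hmp.map_eq]; exact hint.aestronglyMeasurable)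
  rw [hmp.map_eq] at h
  exact h.symm

/-- For a convex loss, the expected risk of CAEW is at most the mean of the expected risks of the
aggregates that it averages. -/
lemma integral_risk_caew_le {B : ℝ} (hφ : Measurable φ)
    (hB : ∀ x ∈ Set.Icc (-1 : ℝ) 1, φ x ∈ Set.Icc 0 B) (hconv : ConvexOn ℝ (Set.Icc (-1) 1) φ)
    {π : Measure (Obs 𝒳)} [IsProbabilityMeasure π] (hM : 2 ≤ M) (hf : IsDictionary f)
    (hn : 1 ≤ n) :
    ∫ D, risk φ π (caew φ β f n D) ∂sampleLaw π n ≤ (1 / (n : ℝ)) * ∑ k ∈ Finset.range n,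
      ∫ D, risk φ π (aewTemp φ β f (k + 1) D) ∂sampleLaw π (k + 1) := by
  have hn0 : (n : ℝ) ≠ 0 := by positivity
  have hTI : ∀ (k : ℕ) (D : Sample 𝒳 k) x, aewTemp φ β f k D x ∈ Set.Icc (-1 : ℝ) 1 :=
    fun k => aewTemp_mem_Icc hM hf.2
  have hTS : ∀ k : ℕ, IsStatistic (aewTemp φ β f k) := isStatistic_aewTemp hφ hf.1
  have hCS : IsStatistic (caew φ β f n) := isStatistic_caew hφ hf.1 n
  have hTm : ∀ (k : ℕ) (D : Sample 𝒳 k), Measurable (aewTemp φ β f k D) :=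
    fun k D => (hTS k).measurable_apply D
  have hCm : ∀ D : Sample 𝒳 n, Measurable (caew φ β f n D) := fun D => hCS.measurable_apply D
  obtain ⟨S, hS⟩ : ∃ S : Fin n → Sample 𝒳 n → 𝒳 → ℝ, ∀ k D, S k D =
    aewTemp φ β f (k + 1) (firstObs (Nat.succ_le_of_lt k.isLt) D) := ⟨_, fun _ _ => rfl⟩
  have hSI : ∀ k D x, S k D x ∈ Set.Icc (-1 : ℝ) 1 := fun k D x => by
    rw [hS]
    exact hTI _ _ _
  have hSint : ∀ k D, Integrable (lossAt φ (S k D)) π := fun k D => by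
    rw [hS]
    exact integrable_lossAt hφ hB (hTm _ _) (hTI _ _)
  have hcaew : ∀ D x, caew φ β f n D x = (1 / (n : ℝ)) * ∑ k, S k D x := by
    intro D x
    simp only [hS, caew]
  have hpt : ∀ D, risk φ π (caew φ β f n D) ≤ (1 / (n : ℝ)) * ∑ k : Fin n, risk φ π (S k D) := by
    intro D
    have : (1 / (n : ℝ)) * ∑ k : Fin n, risk φ π (S k D)
        = ∫ z, (1 / (n : ℝ)) * ∑ k : Fin n, lossAt φ (S k D) z ∂π := by
      rw [integral_const_mul, integral_finsetSum _ fun k _ => hSint k D]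
      rfl
    rw [this]
    refine integral_mono (integrable_lossAt hφ hB (hCm D) (caew_mem_Icc hM hf.2 D))
      ((integrable_finsetSum _ fun k _ => hSint k D).const_mul _) fun z => ?_
    have hj := hconv.map_sum_le (t := Finset.univ) (w := fun _ : Fin n => 1 / (n : ℝ))
      (p := fun k => (z.2 : ℝ) * S k D z.1) (fun _ _ => by positivity) (by simp [hn0])
      fun k _ => label_mul_mem_Icc z.2 (hSI _ _ _)
    simp only [smul_eq_mul, ← Finset.mul_sum] at hj
    rw [mul_left_comm, ← hcaew] at hj
    exact hj
  have hint : ∀ k : Fin n, Integrable (fun D => risk φ π (S k D)) (sampleLaw π n) ∧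
      ∫ D, risk φ π (S k D) ∂sampleLaw π n
        = ∫ D, risk φ π (aewTemp φ β f (k + 1) D) ∂sampleLaw π (k + 1) := by
    intro k
    simp only [hS]
    exact integral_risk_firstObs (T := aewTemp φ β f (k + 1)) hφ hB (Nat.succ_le_of_lt k.isLt)
      (hTS _) (hTI _)
  refine (integral_mono (integrable_risk_of_mem_Icc hφ hB hCS
    fun D => caew_mem_Icc hM hf.2 D)
    ((integrable_finsetSum _ fun k _ => (hint k).1).const_mul _) hpt).trans (le_of_eq ?_)
  rw [integral_const_mul, integral_finsetSum _ fun k _ => (hint k).1]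
  congr 1
  rw [Finset.sum_range]
  exact Finset.sum_congr rfl fun k _ => (hint k).2

end Weights

/-! ### The hinge loss -/

section Hinge

lemma measurable_phi (h : ℝ) : Measurable (phi h) := by
  unfold phi
  split_ifs
  · refine (measurable_const.mul (measurable_const.max (measurable_const.sub measurable_id))).add
      (measurable_const.mul ?_)
    exact Measurable.ite measurableSet_Iic measurable_const measurable_const
  · fun_prop

lemma phi_mem_Icc_of_le_one {h : ℝ} (h0 : 0 ≤ h) (h1 : h ≤ 1) {x : ℝ}
    (hx : x ∈ Set.Icc (-1 : ℝ) 1) : phi h x ∈ Set.Icc 0 2 := by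
  have hh : hingeLoss x = 1 - x := max_eq_right (by linarith [hx.2])
  have hz : zeroOneLoss x ∈ Set.Icc (0 : ℝ) 1 := by
    unfold zeroOneLoss
    split_ifs <;> simp
  rw [phi, if_pos h1, hh]
  constructor
  · nlinarith [mul_nonneg h0 (sub_nonneg.2 hx.2), mul_nonneg (sub_nonneg.2 h1) hz.1]
  · nlinarith [mul_nonneg h0 (by linarith [hx.1] : 0 ≤ x + 1),
      mul_nonneg (sub_nonneg.2 h1) (sub_nonneg.2 hz.2)]

lemma phi_one_of_mem_Icc {x : ℝ} (hx : x ∈ Set.Icc (-1 : ℝ) 1) : phi 1 x = 1 - x := by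
  have hh : hingeLoss x = 1 - x := max_eq_right (by linarith [hx.2])
  simp [phi, hh]

lemma convexOn_phi_one : ConvexOn ℝ (Set.Icc (-1) 1) (phi 1) := by
  refine ⟨convex_Icc _ _, fun x hx y hy a b ha hb hab => ?_⟩
  rw [phi_one_of_mem_Icc (convex_Icc (-1 : ℝ) 1 hx hy ha hb hab), phi_one_of_mem_Icc hx,
    phi_one_of_mem_Icc hy]
  simp only [smul_eq_mul]
  linarith

variable {𝒳 : Type*} [MeasurableSpace 𝒳] {M : ℕ} {f : Fin M → 𝒳 → ℝ}

/-- On `[-1, 1]` the hinge loss is the affine function `1 - x`, and the weights sum to `1`. -/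
lemma risk_aewTemp_phi_one {π : Measure (Obs 𝒳)} [IsProbabilityMeasure π] (hM : 2 ≤ M)
    (hf : IsDictionary f) {n : ℕ} (D : Sample 𝒳 n) :
    risk (phi 1) π (aewTemp (phi 1) 1 f n D)
      = ∑ j, expWeight (phi 1) 1 f D j * risk (phi 1) π (f j) := by
  have hB : ∀ x ∈ Set.Icc (-1 : ℝ) 1, phi 1 x ∈ Set.Icc 0 2 :=
    fun x hx => phi_mem_Icc_of_le_one zero_le_one le_rfl hx
  have hint : ∀ j, Integrable (lossAt (phi 1) (f j)) π :=
    fun j => integrable_lossAt (measurable_phi 1) hB (hf.1 j) (hf.2 j)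
  simp only [risk, ← integral_const_mul]
  rw [← integral_finsetSum _ fun j _ => (hint j).const_mul _]
  refine integral_congr_ae (ae_of_all _ fun z => ?_)
  simp only [lossAt]
  rw [phi_one_of_mem_Icc (label_mul_mem_Icc _ (aewTemp_mem_Icc hM hf.2 D z.1))]
  simp only [phi_one_of_mem_Icc (label_mul_mem_Icc _ (hf.2 _ z.1)), mul_sub, mul_one,
    Finset.sum_sub_distrib, sum_expWeight hM, aewTemp, Finset.mul_sum]
  congr 1
  exact Finset.sum_congr rfl fun j _ => by ring

lemma integral_risk_aewTemp_phi_one_le {π : Measure (Obs 𝒳)} [IsProbabilityMeasure π]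
    (hM : 2 ≤ M) (hf : IsDictionary f) {n : ℕ} (hn : 1 ≤ n) (i : Fin M) :
    ∫ D, risk (phi 1) π (aewTemp (phi 1) 1 f n D) ∂sampleLaw π n
      ≤ risk (phi 1) π (f i) + 5 / 2 * slowRate n M := by
  have hφ := measurable_phi 1
  have hB : ∀ x ∈ Set.Icc (-1 : ℝ) 1, phi 1 x ∈ Set.Icc 0 2 :=
    fun x hx => phi_mem_Icc_of_le_one zero_le_one le_rfl hx
  have hT := isStatistic_aewTemp (β := 1) hφ hf.1 n
  have hI : ∀ D x, aewTemp (phi 1) 1 f n D x ∈ Set.Icc (-1 : ℝ) 1 := aewTemp_mem_Icc hM hf.2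
  have h1 := integrable_risk_of_mem_Icc (π := π) hφ hB hT hI
  have h2 := integrable_empRisk (π := π) hφ hB (hf.1 i) (hf.2 i) n
  have hn0 : (0 : ℝ) < n := by positivity
  have hlog : 0 ≤ Real.log M / n := by positivity
  -- If `log M / n ≤ 1`, the entropy term is at most its square root, giving `3 / 2 + 1 = 5 / 2`.
  -- Otherwise the rate exceeds `1` and the trivial bound `2` on the risk suffices.
  by_cases hle : Real.log M / n ≤ 1
  · have hs : Real.log M / n ≤ slowRate n M := by
      apply Real.le_sqrt_of_sq_le
      nlinarith
    have := integral_le_of_le_deviation (π := π) hφ hB hM hf hn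
      ((h1.sub h2).sub (integrable_const (Real.log M / n))) fun D => by
        have : Nonempty (Fin M) := ⟨i⟩
        obtain ⟨j, hj⟩ := Finite.exists_max fun j =>
          risk (phi 1) π (f j) - empRisk (phi 1) D (f j)
        refine ⟨j, ?_⟩
        simp only [Pi.sub_apply]
        rw [risk_aewTemp_phi_one hM hf]
        have hg := sum_expWeight_mul_empRisk_le (φ := phi 1) (f := f) hM hn D i
        have hs : ∑ k, expWeight (phi 1) 1 f D k * (risk (phi 1) π (f k) - empRisk (phi 1) D (f k))
            ≤ ∑ k, expWeight (phi 1) 1 f D k *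
              (risk (phi 1) π (f j) - empRisk (phi 1) D (f j)) :=
          Finset.sum_le_sum fun k _ => mul_le_mul_of_nonneg_left (hj k) (expWeight_pos hM D k).le
        rw [← Finset.sum_mul, sum_expWeight hM, one_mul] at hs
        simp only [mul_sub, Finset.sum_sub_distrib] at hs
        linarith
    rw [integral_sub' (h1.sub h2) (integrable_const _), integral_sub' h1 h2,
      integral_empRisk hφ hB (hf.1 i) (hf.2 i) hn] at this
    simp only [integral_const, probReal_univ, one_smul] at this
    linarith
  · have hs : 1 ≤ slowRate n M := Real.one_le_sqrt.2 (not_le.1 hle).le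
    have h3 : ∫ D, risk (phi 1) π (aewTemp (phi 1) 1 f n D) ∂sampleLaw π n ≤ 2 := by
      refine (integral_mono h1 (integrable_const 2) fun D => (risk_mem_Icc hφ hB
        (hT.measurable_apply D) (hI D)).2).trans ?_
      simp
    linarith [(risk_mem_Icc (π := π) hφ hB (hf.1 i) (hf.2 i)).1]

lemma oracleInequality_aew_phi_one (hM : 2 ≤ M) (hf : IsDictionary f) {C : ℝ} (hC : 5 / 2 ≤ C) :
    OracleInequality (phi 1) slowRate C f (aew (phi 1) f) := by
  refine oracleInequality_of_integral_risk_le (measurable_phi 1)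
    (fun x hx => phi_mem_Icc_of_le_one zero_le_one le_rfl hx) hM
    (isStatistic_aewTemp (measurable_phi 1) hf.1) (fun n => aewTemp_mem_Icc hM hf.2)
    fun n hn π hπ i => (integral_risk_aewTemp_phi_one_le hM hf hn i).trans ?_
  have := mul_le_mul_of_nonneg_right hC (slowRate_nonneg n M)
  linarith

lemma sum_one_div_sqrt_le (n : ℕ) :
    ∑ k ∈ Finset.range n, 1 / √((k : ℝ) + 1) ≤ 2 * √(n : ℝ) := by
  induction n with
  | zero => simp
  | succ n ih =>
    rw [Finset.sum_range_succ]
    push_cast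
    have ha : 0 ≤ √(n : ℝ) := Real.sqrt_nonneg _
    have hb : 0 < √((n : ℝ) + 1) := Real.sqrt_pos.2 (by positivity)
    have ha2 : √(n : ℝ) ^ 2 = n := Real.sq_sqrt (by positivity)
    have hb2 : √((n : ℝ) + 1) ^ 2 = n + 1 := Real.sq_sqrt (by positivity)
    have hstep : 1 / √((n : ℝ) + 1) ≤ 2 * √((n : ℝ) + 1) - 2 * √(n : ℝ) := by
      rw [div_le_iff₀ hb]
      nlinarith [sq_nonneg (√((n : ℝ) + 1) - √(n : ℝ))]
    linarith

lemma oracleInequality_caew_phi_one (hM : 2 ≤ M) (hf : IsDictionary f) {C : ℝ} (hC : 5 ≤ C) :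
    OracleInequality (phi 1) slowRate C f (caew (phi 1) 1 f) := by
  have hφ := measurable_phi 1
  have hB : ∀ x ∈ Set.Icc (-1 : ℝ) 1, phi 1 x ∈ Set.Icc 0 2 :=
    fun x hx => phi_mem_Icc_of_le_one zero_le_one le_rfl hx
  refine oracleInequality_of_integral_risk_le hφ hB hM
    (isStatistic_caew hφ hf.1) (fun n => caew_mem_Icc hM hf.2)
    fun n hn π hπ i => (integral_risk_caew_le hφ hB convexOn_phi_one hM hf hn).trans ?_
  have hn0 : (0 : ℝ) < n := by positivity
  have hlog : 0 ≤ Real.log M := by positivity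
  set A := risk (phi 1) π (f i)
  set L := √(Real.log M)
  have hL : 0 ≤ L := Real.sqrt_nonneg _
  have hrate : ∀ k : ℕ, slowRate k M = L / √(k : ℝ) := fun k => Real.sqrt_div hlog _
  -- Averaging `1 / √k` over `k ≤ n` gives at most `2 / √n`, which doubles the constant `5 / 2` of
  -- AEW.
  have hsum : ∑ k ∈ Finset.range n,
      ∫ D, risk (phi 1) π (aewTemp (phi 1) 1 f (k + 1) D) ∂sampleLaw π (k + 1)
      ≤ n * A + 5 * L * √(n : ℝ) := by
    calc _ ≤ ∑ k ∈ Finset.range n, (A + 5 / 2 * L * (1 / √((k : ℝ) + 1))) := by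
          refine Finset.sum_le_sum fun k _ => ?_
          refine (integral_risk_aewTemp_phi_one_le hM hf (Nat.le_add_left 1 k) i).trans
            (le_of_eq ?_)
          rw [hrate]
          push_cast
          ring
      _ = n * A + 5 / 2 * L * ∑ k ∈ Finset.range n, 1 / √((k : ℝ) + 1) := by
          rw [Finset.sum_add_distrib, ← Finset.mul_sum]
          simp
      _ ≤ n * A + 5 / 2 * L * (2 * √(n : ℝ)) := by
          gcongr
          exact sum_one_div_sqrt_le n
      _ = _ := by ring
  calc _ ≤ (1 / (n : ℝ)) * (n * A + 5 * L * √(n : ℝ)) := by gcongr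
    _ = A + 5 * (L / √(n : ℝ)) := by
        have hs : √(n : ℝ) ≠ 0 := (Real.sqrt_pos.2 hn0).ne'
        have hs2 : √(n : ℝ) * √(n : ℝ) = n := Real.mul_self_sqrt hn0.le
        field_simp
        linear_combination 5 * L * hs2
    _ ≤ A + C * slowRate n M := by
        rw [hrate]
        gcongr

end Hinge

/-! ### Exponentially concave losses -/

section ExpConcave

variable {𝒳 : Type*} {φ : ℝ → ℝ} {β B : ℝ} {M : ℕ} {f : Fin M → 𝒳 → ℝ} {n : ℕ}

/-- By Jensen's inequality for `exp (-φ / β)`, the exponential of minus the loss of the mixture over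
`β` is at least the weighted mean of those of the `f j`. This mean is the ratio of the partition
sums after and before the observation `z`; taking logarithms gives the claim. -/
lemma lossAt_aewTemp_le (hβ : 0 < β)
    (hconc : ConcaveOn ℝ (Set.Icc (-1) 1) fun x => Real.exp (-β⁻¹ * φ x)) (hM : 2 ≤ M)
    (hf : ∀ j x, f j x ∈ Set.Icc (-1 : ℝ) 1) (D : Sample 𝒳 n) (z : Obs 𝒳) :
    lossAt φ (aewTemp φ β f n D) z ≤ β * Real.log (partitionSum φ β f D) - β * Real.log
      (∑ j, Real.exp (-β⁻¹ * (∑ i, lossAt φ (f j) (D i) + lossAt φ (f j) z))) := by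
  have : Nonempty (Fin M) := ⟨⟨0, by omega⟩⟩
  have hZ := partitionSum_pos (φ := φ) (β := β) (f := f) hM D
  have hj := hconc.le_map_sum (t := Finset.univ) (w := fun j => expWeight φ β f D j)
    (p := fun j => (z.2 : ℝ) * f j z.1) (fun j _ => (expWeight_pos hM D j).le)
    (sum_expWeight hM D) fun j _ => label_mul_mem_Icc z.2 (hf j z.1)
  simp only [smul_eq_mul] at hj
  have e1 : ∑ j, expWeight φ β f D j * ((z.2 : ℝ) * f j z.1)
      = (z.2 : ℝ) * aewTemp φ β f n D z.1 := by
    rw [aewTemp, Finset.mul_sum]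
    exact Finset.sum_congr rfl fun j _ => by ring
  have e2 : ∑ j, expWeight φ β f D j * Real.exp (-β⁻¹ * φ ((z.2 : ℝ) * f j z.1))
      = (∑ j, Real.exp (-β⁻¹ * (∑ i, lossAt φ (f j) (D i) + lossAt φ (f j) z)))
        / partitionSum φ β f D := by
    rw [Finset.sum_div]
    refine Finset.sum_congr rfl fun j _ => ?_
    rw [expWeight_eq, mul_add, Real.exp_add, div_mul_eq_mul_div, lossAt]
  have hpos : 0 < ∑ j, Real.exp (-β⁻¹ * (∑ i, lossAt φ (f j) (D i) + lossAt φ (f j) z)) :=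
    Finset.sum_pos (fun j _ => Real.exp_pos _) Finset.univ_nonempty
  rw [e1, e2] at hj
  have hl := Real.log_le_log (div_pos hpos hZ) hj
  rw [Real.log_exp, Real.log_div hpos.ne' hZ.ne'] at hl
  have hl' := mul_le_mul_of_nonneg_left hl hβ.le
  rw [mul_sub, ← mul_assoc, mul_neg, mul_inv_cancel₀ hβ.ne'] at hl'
  simp only [lossAt] at hl' ⊢
  linarith

lemma log_partitionSum_mem_Icc (hβ : 0 < β)
    (hB : ∀ x ∈ Set.Icc (-1 : ℝ) 1, φ x ∈ Set.Icc 0 B) (hM : 2 ≤ M)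
    (hf : ∀ j x, f j x ∈ Set.Icc (-1 : ℝ) 1) (D : Sample 𝒳 n) :
    Real.log (partitionSum φ β f D) ∈ Set.Icc (-β⁻¹ * (n * B)) (Real.log M) := by
  have hZ := partitionSum_pos (φ := φ) (β := β) (f := f) hM D
  have hb : 0 < β⁻¹ := inv_pos.2 hβ
  constructor
  · rw [Real.le_log_iff_exp_le hZ, partitionSum]
    have h1 : ∑ i, lossAt φ (f ⟨0, by omega⟩) (D i) ≤ ∑ _i : Fin n, B :=
      Finset.sum_le_sum fun i _ => (lossAt_mem_Icc hB (hf _) _).2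
    simp only [Finset.sum_const, Finset.card_univ, Fintype.card_fin, nsmul_eq_mul] at h1
    refine le_trans (Real.exp_le_exp.2 ?_) (Finset.single_le_sum
      (f := fun j => Real.exp (-β⁻¹ * ∑ i, lossAt φ (f j) (D i)))
      (fun j _ => (Real.exp_pos _).le) (Finset.mem_univ ⟨0, by omega⟩))
    nlinarith
  · refine Real.log_le_log hZ ?_
    calc partitionSum φ β f D ≤ ∑ _j : Fin M, (1 : ℝ) := by
          refine Finset.sum_le_sum fun j _ => Real.exp_le_one_iff.2 ?_
          have : 0 ≤ ∑ i, lossAt φ (f j) (D i) :=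
            Finset.sum_nonneg fun i _ => (lossAt_mem_Icc hB (hf _) _).1
          nlinarith
      _ = M := by simp

lemma neg_mul_log_partitionSum_le (hβ : 0 < β) (hM : 2 ≤ M) (D : Sample 𝒳 n) (i : Fin M) :
    -β * Real.log (partitionSum φ β f D) ≤ ∑ k, lossAt φ (f i) (D k) := by
  have hZ := partitionSum_pos (φ := φ) (β := β) (f := f) hM D
  have h : -β⁻¹ * ∑ k, lossAt φ (f i) (D k) ≤ Real.log (partitionSum φ β f D) := by
    rw [Real.le_log_iff_exp_le hZ, partitionSum]
    exact Finset.single_le_sum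
      (f := fun j => Real.exp (-β⁻¹ * ∑ k, lossAt φ (f j) (D k)))
      (fun j _ => (Real.exp_pos _).le) (Finset.mem_univ i)
  have h' := mul_le_mul_of_nonneg_left h hβ.le
  rw [← mul_assoc, mul_neg, mul_inv_cancel₀ hβ.ne'] at h'
  linarith

variable [MeasurableSpace 𝒳]

lemma integrable_log_partitionSum (hφ : Measurable φ) (hβ : 0 < β)
    (hB : ∀ x ∈ Set.Icc (-1 : ℝ) 1, φ x ∈ Set.Icc 0 B) (hM : 2 ≤ M) (hf : IsDictionary f)
    (π : Measure (Obs 𝒳)) [IsProbabilityMeasure π] (n : ℕ) :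
    Integrable (fun D => Real.log (partitionSum φ β f D)) (sampleLaw π n) := by
  refine Integrable.of_mem_Icc _ _ ?_ (ae_of_all _ (log_partitionSum_mem_Icc hβ hB hM hf.2))
  refine (Real.measurable_log.comp (Finset.measurable_sum _ fun j _ =>
    Real.measurable_exp.comp (measurable_const.mul (Finset.measurable_sum _ fun i _ =>
      (measurable_lossAt hφ (hf.1 j)).comp (measurable_pi_apply i))))).aemeasurable

/-- One step of the progressive mixture: the expected risk is paid by the increase of the expected
free energy. -/
lemma integral_risk_aewTemp_le (hφ : Measurable φ) (hβ : 0 < β)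
    (hB : ∀ x ∈ Set.Icc (-1 : ℝ) 1, φ x ∈ Set.Icc 0 B)
    (hconc : ConcaveOn ℝ (Set.Icc (-1) 1) fun x => Real.exp (-β⁻¹ * φ x)) (hM : 2 ≤ M)
    (hf : IsDictionary f) (π : Measure (Obs 𝒳)) [IsProbabilityMeasure π] (n : ℕ) :
    ∫ D, risk φ π (aewTemp φ β f n D) ∂sampleLaw π n
      ≤ β * ∫ D, Real.log (partitionSum φ β f D) ∂sampleLaw π n
        - β * ∫ D, Real.log (partitionSum φ β f D) ∂sampleLaw π (n + 1) := by
  let G : Obs 𝒳 × Sample 𝒳 n → ℝ := fun p =>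
    Real.log (∑ j, Real.exp (-β⁻¹ * (∑ i, lossAt φ (f j) (p.2 i) + lossAt φ (f j) p.1)))
  -- The last coordinate of a sample of size `n + 1` plays the part of the new observation, so the
  -- risk and both free energies are integrals over one product space.
  let e := MeasurableEquiv.piFinSuccAbove (fun _ : Fin (n + 1) => Obs 𝒳) (Fin.last n)
  have hmp : MeasurePreserving e (sampleLaw π (n + 1)) (π.prod (sampleLaw π n)) :=
    measurePreserving_piFinSuccAbove (fun _ => π) (Fin.last n)
  have hG : ∀ D, G (e D) = Real.log (partitionSum φ β f D) := by
    intro D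
    simp only [G, e, partitionSum, Fin.sum_univ_castSucc, MeasurableEquiv.piFinSuccAbove_apply,
      Fin.insertNthEquiv_symm_apply, Fin.removeNth, Fin.succAbove_last]
  have hnext := integrable_log_partitionSum (β := β) hφ hβ hB hM hf π (n + 1)
  have hGint : Integrable G (π.prod (sampleLaw π n)) := by
    rw [← hmp.integrable_comp_emb e.measurableEmbedding]
    exact hnext.congr (ae_of_all _ fun D => (hG D).symm)
  have hGeq : ∫ p, G p ∂π.prod (sampleLaw π n)
      = ∫ D, Real.log (partitionSum φ β f D) ∂sampleLaw π (n + 1) := by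
    rw [← hmp.integral_comp' G]
    exact integral_congr_ae (ae_of_all _ hG)
  have hZint : Integrable (fun p : Obs 𝒳 × Sample 𝒳 n => Real.log (partitionSum φ β f p.2))
      (π.prod (sampleLaw π n)) :=
    (integrable_log_partitionSum (β := β) hφ hβ hB hM hf π n).comp_snd π
  have hZeq : ∫ p : Obs 𝒳 × Sample 𝒳 n, Real.log (partitionSum φ β f p.2) ∂π.prod (sampleLaw π n)
      = ∫ D, Real.log (partitionSum φ β f D) ∂sampleLaw π n := by
    rw [integral_prod_symm _ hZint]
    simp
  have hS : IsStatistic (aewTemp φ β f n) := isStatistic_aewTemp hφ hf.1 n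
  have hfin : HasFiniteExpectedRisk φ π (aewTemp φ β f n) :=
    hasFiniteExpectedRisk_of_mem_Icc hφ hB hS (aewTemp_mem_Icc hM hf.2)
  have hLint : Integrable (fun p : Obs 𝒳 × Sample 𝒳 n => lossAt φ (aewTemp φ β f n p.2) p.1)
      (π.prod (sampleLaw π n)) := hfin.swap
  have hLeq : ∫ p : Obs 𝒳 × Sample 𝒳 n, lossAt φ (aewTemp φ β f n p.2) p.1 ∂π.prod (sampleLaw π n)
      = ∫ D, risk φ π (aewTemp φ β f n D) ∂sampleLaw π n := integral_prod_symm _ hLint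
  rw [← hLeq, ← hZeq, ← hGeq, ← integral_const_mul, ← integral_const_mul,
    ← integral_sub (hZint.const_mul β) (hGint.const_mul β)]
  exact integral_mono hLint ((hZint.const_mul β).sub (hGint.const_mul β))
    fun p => lossAt_aewTemp_le hβ hconc hM hf.2 p.2 p.1

/-- CAEW attains the fast rate for a convex loss that is exponentially concave on `[-1, 1]`. -/
lemma oracleInequality_caew_of_expConcave (hφ : Measurable φ) (hβ : 0 < β) (hB0 : 0 ≤ B)
    (hB : ∀ x ∈ Set.Icc (-1 : ℝ) 1, φ x ∈ Set.Icc 0 B) (hconv : ConvexOn ℝ (Set.Icc (-1) 1) φ)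
    (hconc : ConcaveOn ℝ (Set.Icc (-1) 1) fun x => Real.exp (-β⁻¹ * φ x)) (hM : 2 ≤ M)
    (hf : IsDictionary f) : OracleInequality φ fastRate (β + 2 * B) f (caew φ β f) := by
  refine oracleInequality_of_integral_risk_le hφ hB hM
    (isStatistic_caew hφ hf.1) (fun n => caew_mem_Icc hM hf.2)
    fun n hn π hπ i => (integral_risk_caew_le hφ hB hconv hM hf hn).trans ?_
  have hn0 : (0 : ℝ) < n := by positivity
  set A := risk φ π (f i)
  have hA : A ≤ B := (risk_mem_Icc hφ hB (hf.1 i) (hf.2 i)).2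
  let E : ℕ → ℝ := fun k => β * ∫ D, Real.log (partitionSum φ β f D) ∂sampleLaw π k
  -- CAEW starts at `k = 1`, so the sum telescopes from `E 1` to `E (n + 1)`, and the final term
  -- costs `(n + 1) A` instead of `n A`.
  have hsum : ∑ k ∈ Finset.range n,
      ∫ D, risk φ π (aewTemp φ β f (k + 1) D) ∂sampleLaw π (k + 1) ≤ E 1 - E (n + 1) := by
    have := Finset.sum_range_sub' (fun k => E (k + 1)) n
    rw [zero_add] at this
    rw [← this]
    exact Finset.sum_le_sum fun k _ => integral_risk_aewTemp_le hφ hβ hB hconc hM hf π (k + 1)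
  have hE1 : E 1 ≤ β * Real.log M := by
    refine mul_le_mul_of_nonneg_left ?_ hβ.le
    refine (integral_mono (integrable_log_partitionSum hφ hβ hB hM hf π 1)
      (integrable_const (Real.log M)) fun D =>
        (log_partitionSum_mem_Icc hβ hB hM hf.2 D).2).trans ?_
    simp
  have hEn : -E (n + 1) ≤ (n + 1) * A := by
    have h1 := integral_mono
      ((integrable_log_partitionSum (β := β) hφ hβ hB hM hf π (n + 1)).const_mul (-β))
      (integrable_finsetSum Finset.univ fun k _ =>
        integrable_lossAt_eval (π := π) hφ hB (hf.1 i) (hf.2 i) k)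
      fun D => neg_mul_log_partitionSum_le hβ hM D i
    rw [integral_const_mul, integral_sum_lossAt hφ hB (hf.1 i) (hf.2 i)] at h1
    push_cast at h1
    linarith
  -- The surplus `A ≤ B` is absorbed as `2 B log M`, whence the constant `β + 2 B`.
  have hlog : 1 ≤ 2 * Real.log M := by
    have h2 : (2 : ℝ) ≤ M := by exact_mod_cast hM
    linarith [Real.log_le_log (by norm_num) h2, Real.log_two_gt_d9]
  calc _ ≤ (1 / (n : ℝ)) * (n * A + (β + 2 * B) * Real.log M) := by
        refine mul_le_mul_of_nonneg_left ?_ (by positivity)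
        nlinarith
    _ = A + (β + 2 * B) * fastRate n M := by
        rw [fastRate]
        field_simp

end ExpConcave

/-! ### The quadratic losses, `h > 1` -/

section Quadratic

variable {h : ℝ}

lemma phi_of_one_lt (h1 : 1 < h) (x : ℝ) : phi h x = (h - 1) * x ^ 2 - x + 1 :=
  if_neg (not_le.2 h1)

lemma phi_mem_Icc_of_one_lt (h1 : 1 < h) {x : ℝ} (hx : x ∈ Set.Icc (-1 : ℝ) 1) :
    phi h x ∈ Set.Icc 0 (h + 1) := by
  rw [phi_of_one_lt h1]
  have hx2 : x ^ 2 ≤ 1 := by nlinarith [hx.1, hx.2]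
  constructor
  · nlinarith [hx.2, mul_nonneg (sub_nonneg.2 h1.le) (sq_nonneg x)]
  · nlinarith [hx.1, mul_nonneg (sub_nonneg.2 h1.le) (sub_nonneg.2 hx2)]

lemma convexOn_phi_of_one_lt (h1 : 1 < h) : ConvexOn ℝ (Set.Icc (-1) 1) (phi h) := by
  refine ⟨convex_Icc _ _, fun x _ y _ a b ha hb hab => ?_⟩
  simp only [phi_of_one_lt h1, smul_eq_mul]
  obtain rfl : b = 1 - a := by linarith
  nlinarith [mul_nonneg (mul_nonneg ha hb) (mul_nonneg (sub_nonneg.2 h1.le) (sq_nonneg (x - y)))]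

lemma temperature_pos (h1 : 1 < h) : 0 < temperature h := by
  have h2 : 0 < h - 1 := by linarith
  have h3 : 0 < 2 * h - 1 := by linarith
  unfold temperature
  positivity

/-- The second derivative of `exp (-c φ)` has the sign of `c φ'² - φ''`. Here `φ'' = 2 (h - 1)`,
while `|φ'| = |2 (h - 1) x - 1|` is at most `2 h - 1` on `[-1, 1]`, with equality at `x = -1`; this
dictates the value of the temperature. -/
lemma concaveOn_exp_neg_phi (h1 : 1 < h) :
    ConcaveOn ℝ (Set.Icc (-1) 1) fun x => Real.exp (-(temperature h)⁻¹ * phi h x) := by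
  have hβ := temperature_pos h1
  set c := (temperature h)⁻¹ with hc
  have hc0 : 0 < c := inv_pos.2 hβ
  have hcc : c * (2 * h - 1) ^ 2 = 2 * (h - 1) := by
    have h2 : 0 < h - 1 := by linarith
    have h3 : 0 < 2 * h - 1 := by linarith
    rw [hc, temperature]
    field_simp
  simp only [phi_of_one_lt h1]
  have hq : ∀ x : ℝ, HasDerivAt (fun x : ℝ => -c * ((h - 1) * x ^ 2 - x + 1))
      (-c * (2 * (h - 1) * x - 1)) x := by
    intro x
    have := ((((hasDerivAt_pow 2 x).const_mul (h - 1)).sub (hasDerivAt_id x)).add_const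
      (1 : ℝ)).const_mul (-c)
    refine this.congr_deriv ?_
    push_cast
    ring
  have hq' : ∀ x : ℝ, HasDerivAt (fun x : ℝ => -c * (2 * (h - 1) * x - 1))
      (-c * (2 * (h - 1))) x := by
    intro x
    simpa using ((((hasDerivAt_id x).const_mul (2 * (h - 1))).sub_const (1 : ℝ)).const_mul (-c))
  refine concaveOn_of_hasDerivWithinAt2_nonpos (convex_Icc _ _) (by fun_prop)
    (fun x _ => (hq x).exp.hasDerivWithinAt)
    (fun x _ => ((hq x).exp.mul (hq' x)).hasDerivWithinAt) fun x hx => ?_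
  have hx' : x ∈ Set.Icc (-1 : ℝ) 1 := interior_subset hx
  have hsq : (2 * (h - 1) * x - 1) ^ 2 ≤ (2 * h - 1) ^ 2 := by
    apply sq_le_sq'
    · nlinarith [hx'.1]
    · nlinarith [hx'.2]
  have hmain : (-c * (2 * (h - 1) * x - 1)) * (-c * (2 * (h - 1) * x - 1)) + -c * (2 * (h - 1))
      ≤ 0 := by
    have := mul_le_mul_of_nonneg_left (mul_le_mul_of_nonneg_left hsq hc0.le) hc0.le
    rw [hcc] at this
    nlinarith
  have := mul_nonpos_of_nonneg_of_nonpos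
    (Real.exp_pos (-c * ((h - 1) * x ^ 2 - x + 1))).le hmain
  linarith

end Quadratic

end Aggregation

theorem theorem2 (h : ℝ) (hh : 0 ≤ h) :
    ∃ C₁ : ℝ, 0 < C₁ ∧ ∃ C₂ : ℝ, 0 < C₂ ∧ ∀ (𝒳 : Type*) [MeasurableSpace 𝒳] [MeasurableSingletonClass 𝒳]
      [Infinite 𝒳] (M : ℕ), 2 ≤ M →
      (h < 1 →
        Aggregation.IsOptimalRate 𝒳 M (Aggregation.phi h) Aggregation.slowRate C₁ C₂ ∧
        ∀ f : Fin M → 𝒳 → ℝ, Aggregation.IsDictionary f →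
          (∃ T, Aggregation.IsERM (Aggregation.phi h) f T) ∧
          ∀ T, Aggregation.IsERM (Aggregation.phi h) f T →
            Aggregation.OracleInequality (Aggregation.phi h) Aggregation.slowRate C₁ f T) ∧
      (h = 1 →
        Aggregation.IsOptimalRate 𝒳 M (Aggregation.phi h) Aggregation.slowRate C₁ C₂ ∧
        ∀ f : Fin M → 𝒳 → ℝ, Aggregation.IsDictionary f →
          (∃ T, Aggregation.IsERM (Aggregation.phi h) f T) ∧
          (∀ T, Aggregation.IsERM (Aggregation.phi h) f T →
            Aggregation.OracleInequality (Aggregation.phi h) Aggregation.slowRate C₁ f T) ∧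
          Aggregation.OracleInequality (Aggregation.phi h) Aggregation.slowRate C₁ f
            (Aggregation.aew (Aggregation.phi h) f) ∧
          Aggregation.OracleInequality (Aggregation.phi h) Aggregation.slowRate C₁ f
            (Aggregation.caew (Aggregation.phi h) 1 f)) ∧
      (1 < h →
        Aggregation.IsOptimalRate 𝒳 M (Aggregation.phi h) Aggregation.fastRate C₁ C₂ ∧
        ∀ f : Fin M → 𝒳 → ℝ, Aggregation.IsDictionary f →
          Aggregation.OracleInequality (Aggregation.phi h) Aggregation.fastRate C₁ f
            (Aggregation.caew (Aggregation.phi h) (Aggregation.temperature h) f)) := by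
  open Aggregation in
  rcases le_or_gt h 1 with h1 | h1
  · have hB : ∀ x ∈ Set.Icc (-1 : ℝ) 1, phi h x ∈ Set.Icc 0 2 :=
      fun x hx => phi_mem_Icc_of_le_one hh h1 hx
    -- The constant `5` is the one needed by CAEW at `h = 1`; ERM needs `3 / 2` and AEW `5 / 2`.
    refine ⟨5, by norm_num, 1 / 64, by norm_num, fun 𝒳 _ _ _ M hM => ?_⟩
    have hERM : ∀ f : Fin M → 𝒳 → ℝ, IsDictionary f → (∃ T, IsERM (phi h) f T) ∧
        ∀ T, IsERM (phi h) f T → OracleInequality (phi h) slowRate 5 f T := fun f hf =>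
      ⟨exists_isERM (measurable_phi h) hM hf, fun T hT =>
        oracleInequality_of_isERM (measurable_phi h) hB hM hf hT (by norm_num)⟩
    have hopt : IsOptimalRate 𝒳 M (phi h) slowRate 5 (1 / 64) :=
      ⟨fun f hf => (hERM f hf).1.imp (hERM f hf).2,
        exists_minimaxLowerBound_slowRate hh h1 𝒳 hM⟩
    refine ⟨fun _ => ⟨hopt, hERM⟩, fun h_eq => ⟨hopt, fun f hf => ?_⟩,
      fun h_gt => absurd h1 (not_le.2 h_gt)⟩
    refine ⟨(hERM f hf).1, (hERM f hf).2, ?_⟩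
    subst h_eq
    exact ⟨oracleInequality_aew_phi_one hM hf (by norm_num),
      oracleInequality_caew_phi_one hM hf le_rfl⟩
  · obtain ⟨C, hC, hlow⟩ := exists_minimaxLowerBound_fastRate h1
    have hβ := temperature_pos h1
    refine ⟨temperature h + 2 * (h + 1), by linarith, C, hC, fun 𝒳 _ _ _ M hM => ?_⟩
    have hup : ∀ f : Fin M → 𝒳 → ℝ, IsDictionary f → OracleInequality (phi h) fastRate
        (temperature h + 2 * (h + 1)) f (caew (phi h) (temperature h) f) := fun f hf =>
      oracleInequality_caew_of_expConcave (measurable_phi h) hβ (by linarith)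
        (fun x hx => phi_mem_Icc_of_one_lt h1 hx) (convexOn_phi_of_one_lt h1)
        (concaveOn_exp_neg_phi h1) hM hf
    exact ⟨fun h_lt => absurd h1 (not_lt.2 h_lt.le), fun h_eq => absurd h_eq h1.ne',
      fun _ => ⟨⟨fun f hf => ⟨_, hup f hf⟩, hlow 𝒳 hM⟩, hup⟩⟩
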